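/- Let $W_1,W_2,\ldots$ be i.i.d. uniform on $[0,1]$, let $P_i=(1-W_1)\cdots(1-W_{i-1})W_i$ (uniform stick-breaking, the GEM$(1)$ model), $R_k=P_1+\cdots+P_k$ with $R_0=0$, and $I_k=[R_{k-1},R_k)$. Let $U_1,U_2,\ldots$ be i.i.d. uniform on $[0,1]$, with $(U_j)_{j\ge1}$ independent of $(P_i)_{i\ge1}$. For $k\ge1$ let $n(k,1)=\inf\{n\ge1: U_n\notin[0,R_k)\}\in\{1,2,\ldots\}\cup\{\infty\}$ and $$u_k=\mathbb P\Big(\bigcap_{i=1}^k\{U_j\in I_i\text{ for some }1\le j<n(k,1)\}\Big),$$ the probability that the first $k$ intervals are also the first $k$ intervals to be discovered by the sample points; put $u_0=1$. Then $(u_k)_{k\ge0}$ is a renewal sequence, i.e. $u_0=1$ and there are $f_1,f_2,\ldots\ge0$ with $\sum_{k\ge1} f_k\le1$ and $u_k=\sum_{j=1}^k f_j u_{k-j}$ for all $k\ge1$. Moreover, $(u_k)_{k\ge0}$ is characterized by any one of the following conditions: for every real sequence $(v_k)_{k\ge0}$, the statement "$v_k=u_k$ for all $k\ge0$" and each of the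 following four statements are equivalent. 1. $v_0=1$, $v_1=\tfrac12$, and $2v_k+3v_{k-1}+v_{k-2}=2\zeta(k)$ for all $k\ge2$. 2. For all $k\ge0$, $\displaystyle v_k=(-1)^{k-1}\Big(2-\frac{3}{2^k}\Big)+\sum_{j=2}^k(-1)^{k-j}\Big(2-\frac1{2^{k-j}}\Big)\zeta(j)$. 3. For all $k\ge0$, $\displaystyle v_k=\sum_{j=1}^\infty\frac{2}{j^k(j+1)(j+2)}$. 4. For all complex $z$ with $|z|<1$, the series $\sum_{k\ge0}v_kz^k$ converges and $\displaystyle \sum_{k=0}^\infty v_kz^k=\frac{2}{(1+z)(2+z)}\Big[1+\big(2-\gamma-\psi(1-z)\big)z\Big]$, where $\gamma$ is the Euler constant and $\psi=\Gamma'/\Gamma$ is the digamma function. Consequently $u_k\to\tfrac13$ as $k\to\infty$. -/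

import Mathlib

open MeasureTheory ProbabilityTheory Filter Topology

noncomputable section

namespace StickBreaking

variable {Ω : Type*}

/-- Length of the stick-breaking intervals. Indices are shifted by one: `W i` is the factor `W_{i+1}`
and `stickLength W i` is `P_{i+1} = (1 - W_1) ⋯ (1 - W_i) W_{i+1}`. -/
def stickLength (W : ℕ → Ω → ℝ) (i : ℕ) (ω : Ω) : ℝ :=
  (∏ j ∈ Finset.range i, (1 - W j ω)) * W i ω

/-- The end point `R_k = P_1 + ⋯ + P_k`, with `R_0 = 0`. -/
def stickEnd (W : ℕ → Ω → ℝ) (k : ℕ) (ω : Ω) : ℝ :=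
  ∑ i ∈ Finset.range k, stickLength W i ω

/-- The interval `I_{i+1} = [R_i, R_{i+1})`. -/
def stickInterval (W : ℕ → Ω → ℝ) (i : ℕ) (ω : Ω) : Set ℝ :=
  Set.Ico (stickEnd W i ω) (stickEnd W (i + 1) ω)

/-- The first index `n` such that the sample point `U n` is not in `[0, R_k)`; it is `⊤` if there is
no such index. (Sample points are numbered from `0`.) -/
def exitTime (W U : ℕ → Ω → ℝ) (k : ℕ) (ω : Ω) : ℕ∞ :=
  ⨅ (n : ℕ) (_ : U n ω ∉ Set.Ico 0 (stickEnd W k ω)), (n : ℕ∞)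

/-- The event that each of the first `k` intervals contains a sample point drawn before the first
sample point outside `[0, R_k)`, that is, the first `k` intervals are also the first `k`
intervals to be discovered. -/
def discoveryEvent (W U : ℕ → Ω → ℝ) (k : ℕ) : Set Ω :=
  {ω | ∀ i < k, ∃ j : ℕ, (j : ℕ∞) < exitTime W U k ω ∧ U j ω ∈ stickInterval W i ω}

/-- The probabilities `u_k`, with the convention `u_0 = 1`. -/
def renewalProb [MeasurableSpace Ω] (μ : Measure Ω) (W U : ℕ → Ω → ℝ) : ℕ → ℝ
  | 0 => 1
  | k + 1 => μ.real (discoveryEvent W U (k + 1))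

/-- `u` is a renewal sequence: `u_0 = 1` and `u_k = f_k u_0 + f_{k-1} u_1 + ⋯ + f_1 u_{k-1}` for
`k ≥ 1`, where `f_k` (the probability that the first renewal is at time `k`) is nonnegative and
`f_1 + f_2 + ⋯ ≤ 1`. The value `f 0` plays no role. -/
def IsRenewalSequence (u : ℕ → ℝ) : Prop :=
  u 0 = 1 ∧ ∃ f : ℕ → ℝ, (∀ k, 0 ≤ f k) ∧
    (Summable fun k => f (k + 1)) ∧ ∑' k, f (k + 1) ≤ 1 ∧
    ∀ k, 1 ≤ k → u k = ∑ j ∈ Finset.Icc 1 k, f j * u (k - j)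

/-- The recursion. -/
def ZetaRecursion (v : ℕ → ℝ) : Prop :=
  v 0 = 1 ∧ v 1 = 1 / 2 ∧
    ∀ k : ℕ, 2 ≤ k →
      2 * (v k : ℂ) + 3 * (v (k - 1) : ℂ) + (v (k - 2) : ℂ) = 2 * riemannZeta (k : ℂ)

/-- The explicit rational combination of `1, ζ(2), …, ζ(k)`. -/
def ZetaCombination (v : ℕ → ℝ) : Prop :=
  ∀ k : ℕ, (v k : ℂ) =
    (-1 : ℂ) ^ ((k : ℤ) - 1) * (2 - 3 / 2 ^ k) +
      ∑ j ∈ Finset.Icc 2 k, (-1 : ℂ) ^ (k - j) * (2 - 1 / 2 ^ (k - j)) * riemannZeta (j : ℂ)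

/-- The series with positive terms. -/
def PositiveSeries (v : ℕ → ℝ) : Prop :=
  ∀ k : ℕ, HasSum (fun j : ℕ+ => 2 / ((j : ℝ) ^ k * ((j : ℝ) + 1) * ((j : ℝ) + 2))) (v k)

/-- The generating function on the open unit disc. -/
def GeneratingFunction (v : ℕ → ℝ) : Prop :=
  ∀ z : ℂ, ‖z‖ < 1 →
    HasSum (fun k : ℕ => (v k : ℂ) * z ^ k)
      (2 / ((1 + z) * (2 + z)) *
        (1 + (2 - (Real.eulerMascheroniConstant : ℂ) - Complex.digamma (1 - z)) * z))

end StickBreaking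

end

noncomputable section

namespace StickBreaking

/-! Let `Q = ∏_{i<k} (1 - W i)` be the length left over by the first `k` sticks. Given the sticks,
the event means, up to a null set, that for some `n` the first `n` points lie in the first `k`
intervals and hit all of them, and the next point leaves. The conditional probability is `Q` times a
sum over surjections (`measure_isDiscovering`). To average over the sticks, remove the last
interval: its points then count as exits, so the quantity to follow is the probability of discovery
before exit number `ρ + 1` (`discoveryWeight_eq`). The last factor is independent of the earlier
ones, and a Beta integral gives a linear recursion in `k` with coefficients `(ρ+1)/((m+ρ+2)(m+ρ+3))`
(`lintegral_discoveryWeight_succ`). For each `j ≥ 1` the function `ρ ↦ (ρ+1)/binom(j+ρ+2, j)` is an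
eigenvector with eigenvalue `1/j`, and these functions sum to 1. At `ρ = 0` the solution is `∑_j
2/(j^k (j+1)(j+2))` (`eq_tsum_of_recursion`, `hasSum_renewalProb`).

The rest concerns this series alone. It is the moment sequence of a probability on the points `1/j`,
hence log-convex and nonincreasing, and Kaluza's theorem makes it a renewal sequence
(`isRenewalSequence_of_logConvex`). Since `j² + 3j + 2 = (j+1)(j+2)`, it satisfies the zeta
recursion, which has an explicit solution (`zetaCombinationValue_recursion`). Summing over `k`
first, then using partial fractions in `j` and the digamma series (`hasSum_digamma_one_sub`), gives
the generating function. Only the term `j = 1` survives as `k → ∞`, which gives 1/3. -/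

open scoped ENNReal

/-! ### Weights of surjections and of discovery -/

/-- The sum of `∏ i, p (c i)` over all surjections `c` from an `n`-element set onto
`{0, …, k - 1}`. -/
def surjWeight (p : ℕ → ℝ≥0∞) : ℕ → ℕ → ℝ≥0∞
  | 0, n => if n = 0 then 1 else 0
  | k + 1, n => ∑ l ∈ Finset.range n, (n.choose l : ℝ≥0∞) * p k ^ (n - l) * surjWeight p k l

/-- With `x i = W i` and `y i = 1 - W i`, the conditional probability given the sticks that the
first `k` intervals are discovered before the sample has left their union `ρ + 1` times. -/
def discoveryWeight (x y : ℕ → ℝ≥0∞) : ℕ → ℕ → ℝ≥0∞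
  | 0, _ => 1
  | k + 1, ρ => ∑' m : ℕ, ((m + 1 + ρ).choose (m + 1) : ℝ≥0∞) * x k ^ (m + 1) * y k ^ (ρ + 1) *
      discoveryWeight x y k (ρ + m + 1)

lemma tsum_sum_range_eq_tsum_tsum (f : ℕ → ℕ → ℝ≥0∞) :
    ∑' n, ∑ l ∈ Finset.range n, f n l = ∑' m, ∑' l, f (l + m + 1) l := by
  have h : ∀ n, ∑ l ∈ Finset.range n, f n l = ∑' l, if l < n then f n l else 0 := by
    intro n
    rw [tsum_eq_sum (s := Finset.range n)]
    · exact Finset.sum_congr rfl fun l hl => by rw [if_pos (Finset.mem_range.1 hl)]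
    · intro l hl
      rw [if_neg (by simpa using hl)]
  simp_rw [h]
  rw [ENNReal.tsum_comm]
  conv_rhs => rw [ENNReal.tsum_comm]
  refine tsum_congr fun l => ?_
  rw [← Summable.sum_add_tsum_nat_add' (k := l + 1) ENNReal.summable]
  rw [Finset.sum_eq_zero, zero_add]
  · refine tsum_congr fun m => ?_
    rw [if_pos (by omega)]
    congr 1
    omega
  · intro n hn
    rw [if_neg]
    have := Finset.mem_range.1 hn
    omega

/-- Both products are the trinomial coefficient `(l+m+1+ρ)! / (l! (m+1)! ρ!)`. -/
lemma choose_mul_choose_shift (l m ρ : ℕ) :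
    (l + m + 1 + ρ).choose (l + m + 1) * (l + m + 1).choose l =
      (m + 1 + ρ).choose (m + 1) * (l + (ρ + m + 1)).choose l := by
  have h := Nat.choose_mul (n := l + m + 1 + ρ) (k := l + m + 1) (s := l) (by omega)
  rw [h, mul_comm, show l + m + 1 + ρ - l = m + 1 + ρ by omega,
    show l + m + 1 - l = m + 1 by omega, show l + (ρ + m + 1) = l + m + 1 + ρ by omega]

/-- Negative binomial counting: `n` inside points and `ρ + 1` exits, the last draw being an exit,
can be interleaved in `binom(n+ρ, n)` ways. When interval `k` is removed, its `m + 1` points become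
exits, so `ρ` becomes `ρ + m + 1`. -/
theorem discoveryWeight_eq (x y p : ℕ → ℝ≥0∞)
    (hp : ∀ i, p i = (∏ j ∈ Finset.range i, y j) * x i) (k ρ : ℕ) :
    discoveryWeight x y k ρ = (∏ j ∈ Finset.range k, y j) ^ (ρ + 1) *
      ∑' n, ((n + ρ).choose n : ℝ≥0∞) * surjWeight p k n := by
  induction k generalizing ρ with
  | zero =>
    rw [tsum_eq_single 0]
    · simp [discoveryWeight, surjWeight]
    · intro n hn
      simp [surjWeight, hn]
  | succ k ih =>
    simp only [discoveryWeight, surjWeight, Finset.mul_sum]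
    rw [tsum_sum_range_eq_tsum_tsum, ← ENNReal.tsum_mul_left]
    refine tsum_congr fun m => ?_
    rw [ih, ← ENNReal.tsum_mul_left, ← ENNReal.tsum_mul_left, ← ENNReal.tsum_mul_left]
    refine tsum_congr fun l => ?_
    have h : ((l + m + 1 + ρ).choose (l + m + 1) : ℝ≥0∞) * ((l + m + 1).choose l : ℝ≥0∞) =
      ((m + 1 + ρ).choose (m + 1) : ℝ≥0∞) * ((l + (ρ + m + 1)).choose l : ℝ≥0∞) := by
      exact_mod_cast choose_mul_choose_shift l m ρ
    rw [show l + m + 1 - l = m + 1 by omega, hp, Finset.prod_range_succ]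
    set Q := ∏ j ∈ Finset.range k, y j
    calc _ = (((m + 1 + ρ).choose (m + 1) : ℝ≥0∞) * ((l + (ρ + m + 1)).choose l : ℝ≥0∞)) *
          (x k ^ (m + 1) * y k ^ (ρ + 1) * Q ^ (ρ + m + 1 + 1) * surjWeight p k l) := by ring
      _ = _ := by rw [← h]; ring

/-! ### Reciprocal binomial sums and the solution of the averaged recursion -/

/-- The reciprocal binomial coefficient `1 / binom (j + b) b`. -/
def invChoose (b j : ℕ) : ℝ := ((j + b).choose b : ℝ)⁻¹

lemma invChoose_nonneg (b j : ℕ) : 0 ≤ invChoose b j := by unfold invChoose; positivity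

lemma invChoose_sub_succ (b j : ℕ) :
    invChoose b j - invChoose (b + 1) j = j * (invChoose (b + 1) j / ((b : ℝ) + 1)) := by
  have h := Nat.add_one_mul_choose_eq (j + b) b
  have h1 : ((j + b).choose b : ℝ) ≠ 0 := by
    exact_mod_cast (Nat.choose_pos (by omega)).ne'
  have h2 : ((j + (b + 1)).choose (b + 1) : ℝ) ≠ 0 := by
    exact_mod_cast (Nat.choose_pos (by omega)).ne'
  have h' : ((j : ℝ) + b + 1) * ((j + b).choose b : ℝ) =
      ((j + (b + 1)).choose (b + 1) : ℝ) * (b + 1) := by exact_mod_cast h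
  have hb : (b : ℝ) + 1 ≠ 0 := by positivity
  unfold invChoose
  field_simp
  linear_combination -h'

lemma tendsto_invChoose (b j : ℕ) (hj : 1 ≤ j) :
    Tendsto (fun m => invChoose (b + m) j) atTop (𝓝 0) := by
  refine squeeze_zero (fun m => invChoose_nonneg _ _) (fun m => ?_)
    tendsto_one_div_add_atTop_nhds_zero_nat
  unfold invChoose
  rw [← one_div]
  have : m + 1 ≤ (j + (b + m)).choose (b + m) := by
    calc m + 1 ≤ b + m + 1 := by omega
      _ = (1 + (b + m)).choose (b + m) := by
        rw [← Nat.choose_symm_add, Nat.choose_one_right]; omega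
      _ ≤ _ := Nat.choose_le_choose _ (by omega)
  exact one_div_le_one_div_of_le (by positivity) (by exact_mod_cast this)

/-- By `invChoose_sub_succ` the series telescopes. This is the eigenvector identity, with eigenvalue
`1/j`. -/
lemma hasSum_invChoose_div (b j : ℕ) (hj : 1 ≤ j) :
    HasSum (fun m : ℕ => invChoose (b + m + 1) j / ((b : ℝ) + m + 1)) (invChoose b j / j) := by
  have hj0 : (j : ℝ) ≠ 0 := by positivity
  rw [hasSum_iff_tendsto_nat_of_nonneg
    (fun m => div_nonneg (invChoose_nonneg _ _) (by positivity))]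
  have h : ∀ n, ∑ m ∈ Finset.range n, invChoose (b + m + 1) j / ((b : ℝ) + m + 1) =
      (invChoose b j - invChoose (b + n) j) / j := by
    intro n
    rw [eq_div_iff hj0, Finset.sum_mul]
    have := Finset.sum_range_sub' (fun m => invChoose (b + m) j) n
    simp only [add_zero] at this
    rw [← this]
    refine Finset.sum_congr rfl fun m _ => ?_
    rw [← add_assoc, invChoose_sub_succ]
    push_cast
    ring
  simp_rw [h]
  simpa using ((tendsto_const_nhds (x := invChoose b j)).sub (tendsto_invChoose b j hj)).div_const
    (j : ℝ)

/-- Exchanging the roles of the two arguments of the binomial coefficient reduces this to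
`hasSum_invChoose_div` with first argument 1. It expands the constant initial value in eigenvectors.
-/
lemma hasSum_invChoose (b : ℕ) :
    HasSum (fun i : ℕ => invChoose (b + 2) (i + 1)) (1 / ((b : ℝ) + 1)) := by
  have h := (hasSum_invChoose_div 1 (b + 1) (by omega)).mul_left ((b : ℝ) + 2)
  have hv : 1 / ((b : ℝ) + 1) = ((b : ℝ) + 2) * (invChoose 1 (b + 1) / ((b + 1 : ℕ) : ℝ)) := by
    unfold invChoose
    rw [Nat.choose_one_right]
    push_cast
    field_simp
    ring
  rw [hv]
  suffices hf : ∀ i : ℕ, invChoose (b + 2) (i + 1) =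
      ((b : ℝ) + 2) * (invChoose (1 + i + 1) (b + 1) / ((1 : ℕ) + (i : ℝ) + 1)) by
    simpa only [hf] using h
  intro i
  have e := Nat.add_one_mul_choose_eq (i + 2 + b) (b + 1)
  have e1 : (i + 1 + (b + 2)).choose (b + 2) * (b + 2) =
      (i + b + 3) * (i + b + 2).choose (b + 1) := by
    rw [show i + 1 + (b + 2) = i + 2 + b + 1 by omega, ← e]
    ring_nf
  have e2 := Nat.choose_mul_succ_eq (i + b + 2) (b + 1)
  have e3 : (b + 1 + (1 + i + 1)).choose (1 + i + 1) = (i + b + 3).choose (b + 1) := by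
    rw [← Nat.choose_symm_add]; congr 1; omega
  rw [show i + b + 2 + 1 - (b + 1) = i + 2 by omega] at e2
  unfold invChoose
  rw [e3]
  have p1 : ((i + 1 + (b + 2)).choose (b + 2) : ℝ) ≠ 0 := by
    exact_mod_cast (Nat.choose_pos (by omega)).ne'
  have p2 : ((i + b + 3).choose (b + 1) : ℝ) ≠ 0 := by
    exact_mod_cast (Nat.choose_pos (by omega)).ne'
  have e4 : ((i + 1 + (b + 2)).choose (b + 2) : ℝ) * (b + 2) =
      (i + b + 3).choose (b + 1) * (i + 2) := by
    have : (i + 1 + (b + 2)).choose (b + 2) * (b + 2) = (i + b + 3).choose (b + 1) * (i + 2) := by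
      rw [e1, ← e2]; ring
    exact_mod_cast this
  push_cast
  field_simp
  linear_combination -e4

/-- The expectation of `discoveryWeight` as a series. -/
theorem eq_tsum_of_recursion (a : ℕ → ℕ → ℝ≥0∞) (h0 : ∀ ρ, a 0 ρ = 1)
    (hs : ∀ k ρ, a (k + 1) ρ = ∑' m : ℕ,
      ENNReal.ofReal ((ρ + 1) / ((m + ρ + 2) * (m + ρ + 3))) * a k (ρ + m + 1)) (k ρ : ℕ) :
    a k ρ = ∑' i : ℕ, ENNReal.ofReal ((ρ + 1) * invChoose (ρ + 2) (i + 1) / ((i : ℝ) + 1) ^ k) := by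
  induction k generalizing ρ with
  | zero =>
    have h := (hasSum_invChoose ρ).mul_left ((ρ : ℝ) + 1)
    simp only [pow_zero, div_one]
    rw [h0, ← ENNReal.ofReal_tsum_of_nonneg (fun i => mul_nonneg (by positivity)
      (invChoose_nonneg _ _)) h.summable, h.tsum_eq, mul_one_div_cancel (by positivity)]
    simp
  | succ k ih =>
    rw [hs]
    simp_rw [ih, ← ENNReal.tsum_mul_left]
    rw [ENNReal.tsum_comm]
    refine tsum_congr fun i => ?_
    -- With the sums exchanged, one step of the recursion acts on each eigenvector separately and
    -- divides it by `i + 1`.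
    have h := ((hasSum_invChoose_div (ρ + 2) (i + 1) (by omega)).mul_left
      (((ρ : ℝ) + 1) / ((i : ℝ) + 1) ^ k))
    have e : ((ρ : ℝ) + 1) * invChoose (ρ + 2) (i + 1) / ((i : ℝ) + 1) ^ (k + 1) =
        ((ρ : ℝ) + 1) / ((i : ℝ) + 1) ^ k * (invChoose (ρ + 2) (i + 1) / ((i + 1 : ℕ) : ℝ)) := by
      push_cast
      field_simp
      ring
    rw [e, ← h.tsum_eq, ENNReal.ofReal_tsum_of_nonneg _ h.summable]
    · refine tsum_congr fun m => ?_
      rw [← ENNReal.ofReal_mul (by positivity)]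
      congr 1
      rw [show ρ + m + 1 + 2 = ρ + 2 + m + 1 by omega]
      push_cast
      have : (m : ℝ) + ρ + 2 ≠ 0 := by positivity
      have : (m : ℝ) + ρ + 3 ≠ 0 := by positivity
      have : (ρ : ℝ) + 2 + m + 1 ≠ 0 := by positivity
      field_simp
      ring
    · intro m
      exact mul_nonneg (by positivity) (div_nonneg (invChoose_nonneg _ _) (by positivity))

/-! ### Beta integrals and the average over the sticks -/

lemma integral_pow_mul_one_sub_pow (a b : ℕ) :
    ∫ x in (0 : ℝ)..1, x ^ a * (1 - x) ^ b =
      (a.factorial * b.factorial : ℝ) / (a + b + 1).factorial := by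
  induction b generalizing a with
  | zero =>
    simp only [pow_zero, mul_one, integral_pow, one_pow, Nat.factorial_zero, Nat.cast_one,
      Nat.factorial_succ, add_zero]
    have : (a.factorial : ℝ) ≠ 0 := by positivity
    push_cast
    field_simp
    simp
  | succ b ih =>
    have hd : ∀ x : ℝ, HasDerivAt (fun x : ℝ => x ^ (a + 1) * (1 - x) ^ (b + 1))
        (((a : ℝ) + 1) * (x ^ a * (1 - x) ^ (b + 1)) -
          ((b : ℝ) + 1) * (x ^ (a + 1) * (1 - x) ^ b)) x := by
      intro x
      have h1 : HasDerivAt (fun x : ℝ => 1 - x) (-1) x := by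
        simpa using (hasDerivAt_id x).const_sub 1
      refine ((hasDerivAt_pow (a + 1) x).mul (h1.pow (b + 1))).congr_deriv ?_
      simp only [Nat.add_sub_cancel, Nat.cast_add, Nat.cast_one, Pi.pow_apply]
      ring
    have h := intervalIntegral.integral_eq_sub_of_hasDerivAt (a := 0) (b := 1) (fun x _ => hd x)
      (Continuous.intervalIntegrable (by fun_prop) _ _)
    rw [intervalIntegral.integral_sub (Continuous.intervalIntegrable (by fun_prop) _ _)
      (Continuous.intervalIntegrable (by fun_prop) _ _), intervalIntegral.integral_const_mul,
      intervalIntegral.integral_const_mul, ih (a + 1)] at h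
    simp only [sub_self, ne_eq, Nat.add_eq_zero_iff, one_ne_zero, and_false, not_false_eq_true,
      zero_pow, mul_zero, zero_mul] at h
    rw [show a + 1 + b + 1 = a + (b + 1) + 1 by omega] at h
    have h2 : ((a : ℝ) + 1) ≠ 0 := by positivity
    apply mul_left_cancel₀ h2
    rw [sub_eq_zero.1 h, Nat.factorial_succ, Nat.factorial_succ b]
    push_cast
    ring

variable {Ω : Type*} [MeasurableSpace Ω] {μ : Measure Ω}

lemma map_eq_of_isUniform {X : Ω → ℝ} (hu : pdf.IsUniform X (Set.Icc 0 1) μ) :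
    μ.map X = volume.restrict (Set.Icc 0 1) := by
  rw [pdf.IsUniform] at hu
  rw [hu, ProbabilityTheory.cond]
  simp

lemma measure_preimage_of_isUniform {X : Ω → ℝ} (hX : Measurable X)
    (hu : pdf.IsUniform X (Set.Icc 0 1) μ) {A : Set ℝ} (hA : MeasurableSet A) :
    μ (X ⁻¹' A) = volume (A ∩ Set.Icc 0 1) := by
  rw [← Measure.map_apply hX hA, map_eq_of_isUniform hu, Measure.restrict_apply hA]

lemma ae_mem_Ico_of_isUniform {X : Ω → ℝ} (hX : Measurable X)
    (hu : pdf.IsUniform X (Set.Icc 0 1) μ) : ∀ᵐ ω ∂μ, X ω ∈ Set.Ico (0 : ℝ) 1 := by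
  have h := measure_preimage_of_isUniform hX hu (measurableSet_Ico (a := (0 : ℝ)) (b := 1)).compl
  rw [ae_iff]
  change μ (X ⁻¹' (Set.Ico 0 1)ᶜ) = 0
  rw [h]
  refine measure_mono_null (t := {1}) ?_ (by simp)
  rintro x ⟨h1, h2⟩
  simp only [Set.mem_compl_iff, Set.mem_Ico, Set.mem_Icc, not_and, not_lt] at h1 h2
  exact le_antisymm h2.2 (h1 h2.1)

lemma lintegral_pow_mul_one_sub_pow_of_isUniform {X : Ω → ℝ} (hX : Measurable X)
    (hu : pdf.IsUniform X (Set.Icc 0 1) μ) (a b : ℕ) :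
    ∫⁻ ω, ENNReal.ofReal (X ω) ^ a * ENNReal.ofReal (1 - X ω) ^ b ∂μ =
      ENNReal.ofReal ((a.factorial * b.factorial : ℝ) / (a + b + 1).factorial) := by
  have hm : Measurable fun x : ℝ => ENNReal.ofReal x ^ a * ENNReal.ofReal (1 - x) ^ b := by
    fun_prop
  rw [← lintegral_map (f := fun x : ℝ => ENNReal.ofReal x ^ a * ENNReal.ofReal (1 - x) ^ b) hm hX,
    map_eq_of_isUniform hu, ← integral_pow_mul_one_sub_pow,
    intervalIntegral.integral_of_le zero_le_one, ← integral_Icc_eq_integral_Ioc,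
    ofReal_integral_eq_lintegral_ofReal]
  · refine setLIntegral_congr_fun measurableSet_Icc fun x hx => ?_
    have h1 : 0 ≤ 1 - x := sub_nonneg.2 hx.2
    rw [ENNReal.ofReal_mul (pow_nonneg hx.1 _), ENNReal.ofReal_pow hx.1, ENNReal.ofReal_pow h1]
  · exact (Continuous.continuousOn (by fun_prop)).integrableOn_compact isCompact_Icc
  · refine (ae_restrict_iff' measurableSet_Icc).2 (Eventually.of_forall fun x hx => ?_)
    exact mul_nonneg (pow_nonneg hx.1 _) (pow_nonneg (sub_nonneg.2 hx.2) _)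

lemma choose_mul_beta (m ρ : ℕ) :
    ((m + 1 + ρ).choose (m + 1) : ℝ≥0∞) *
      ENNReal.ofReal (((m + 1).factorial * (ρ + 1).factorial : ℝ) /
        (m + 1 + (ρ + 1) + 1).factorial) =
      ENNReal.ofReal ((ρ + 1) / ((m + ρ + 2) * (m + ρ + 3))) := by
  rw [← ENNReal.ofReal_natCast, ← ENNReal.ofReal_mul (by positivity)]
  congr 1
  have h : ((m + 1 + ρ).choose (m + 1) : ℝ) * (m + 1).factorial * ρ.factorial =
      (m + 1 + ρ).factorial := by
    rw [Nat.choose_symm_add]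
    exact_mod_cast Nat.add_choose_mul_factorial_mul_factorial (m + 1) ρ
  have e : ((m + 1 + (ρ + 1) + 1).factorial : ℝ) =
      (m + ρ + 3) * ((m + ρ + 2) * (m + 1 + ρ).factorial) := by
    rw [Nat.factorial_succ, show m + 1 + (ρ + 1) = m + 1 + ρ + 1 by omega, Nat.factorial_succ]
    push_cast
    ring
  have h0 : ((m + 1 + ρ).factorial : ℝ) ≠ 0 := by positivity
  rw [e, Nat.factorial_succ ρ, ← h]
  have hc : ((m + 1 + ρ).choose (m + 1) : ℝ) ≠ 0 := left_ne_zero_of_mul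
    (left_ne_zero_of_mul (h ▸ h0))
  push_cast
  field_simp

/-- The σ-algebra is arbitrary so that the one generated by `W i`, `i < k`, can be used: it is
independent of `W k`. -/
lemma measurable_discoveryWeight {S : Type*} {m : MeasurableSpace S} {x y : ℕ → S → ℝ≥0∞} (k ρ : ℕ)
    (hx : ∀ i < k, Measurable[m] (x i)) (hy : ∀ i < k, Measurable[m] (y i)) :
    Measurable[m] fun ω => discoveryWeight (fun i => x i ω) (fun i => y i ω) k ρ := by
  induction k generalizing ρ with
  | zero => exact measurable_const
  | succ k ih =>
    have h1 := hx k (by omega)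
    have h2 := hy k (by omega)
    simp only [discoveryWeight]
    refine Measurable.tsum fun i => ?_
    exact (((h1.pow_const _).const_mul _).mul (h2.pow_const _)).mul
      (ih _ (fun i hi => hx i (by omega)) fun i hi => hy i (by omega))

theorem lintegral_discoveryWeight_succ [IsProbabilityMeasure μ] {W : ℕ → Ω → ℝ}
    (hWm : ∀ i, Measurable (W i)) (hWu : ∀ i, pdf.IsUniform (W i) (Set.Icc 0 1) μ)
    (hWi : iIndepFun W μ) (k ρ : ℕ) :
    ∫⁻ ω, discoveryWeight (fun i => ENNReal.ofReal (W i ω))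
        (fun i => ENNReal.ofReal (1 - W i ω)) (k + 1) ρ ∂μ =
      ∑' m : ℕ, ENNReal.ofReal ((ρ + 1) / ((m + ρ + 2) * (m + ρ + 3))) *
        ∫⁻ ω, discoveryWeight (fun i => ENNReal.ofReal (W i ω))
          (fun i => ENNReal.ofReal (1 - W i ω)) k (ρ + m + 1) ∂μ := by
  have hx : ∀ i, Measurable fun ω => ENNReal.ofReal (W i ω) := fun i => (hWm i).ennreal_ofReal
  have hy : ∀ i, Measurable fun ω => ENNReal.ofReal (1 - W i ω) := fun i =>
    ((hWm i).const_sub 1).ennreal_ofReal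
  have hA := fun ρ => measurable_discoveryWeight (x := fun i ω => ENNReal.ofReal (W i ω))
    (y := fun i ω => ENNReal.ofReal (1 - W i ω)) k ρ (fun i _ => hx i) (fun i _ => hy i)
  simp only [discoveryWeight]
  rw [lintegral_tsum]
  · refine tsum_congr fun m => ?_
    rw [← choose_mul_beta, ← lintegral_pow_mul_one_sub_pow_of_isUniform (hWm k) (hWu k), mul_assoc]
    simp_rw [mul_assoc]
    have hm : Measurable fun ω => ENNReal.ofReal (W k ω) ^ (m + 1) *
        (ENNReal.ofReal (1 - W k ω) ^ (ρ + 1) * discoveryWeight (fun i => ENNReal.ofReal (W i ω))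
          (fun i => ENNReal.ofReal (1 - W i ω)) k (ρ + m + 1)) :=
      ((hx k).pow_const _).mul (((hy k).pow_const _).mul (hA _))
    rw [lintegral_const_mul _ hm]
    congr 1
    simp_rw [← mul_assoc]
    have hle : ∀ i, MeasurableSpace.comap (W i) inferInstance ≤ ‹MeasurableSpace Ω› :=
      fun i => (hWm i).comap_le
    have hind := indep_iSup_of_disjoint (S := {k}) (T := Set.Iio k) hle hWi.iIndep (by simp)
    refine lintegral_mul_eq_lintegral_mul_lintegral_of_independent_measurableSpace
      (iSup₂_le fun i _ => hle i) (iSup₂_le fun i _ => hle i) hind ?_ ?_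
    · have hk : Measurable[⨆ i ∈ ({k} : Set ℕ), MeasurableSpace.comap (W i) inferInstance] (W k) :=
        (comap_measurable (W k)).mono (le_iSup₂_of_le k rfl le_rfl) le_rfl
      exact (hk.ennreal_ofReal.pow_const _).mul ((hk.const_sub 1).ennreal_ofReal.pow_const _)
    · have hk : ∀ i < k,
          Measurable[⨆ i ∈ Set.Iio k, MeasurableSpace.comap (W i) inferInstance] (W i) :=
        fun i hi => (comap_measurable (W i)).mono (le_iSup₂_of_le i hi le_rfl) le_rfl
      exact measurable_discoveryWeight k _ (fun i hi => (hk i hi).ennreal_ofReal)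
        fun i hi => ((hk i hi).const_sub 1).ennreal_ofReal
  · intro m
    exact ((((hx k).pow_const _).const_mul _).mul ((hy k).pow_const _)).mul (hA _) |>.aemeasurable

theorem lintegral_discoveryWeight [IsProbabilityMeasure μ] {W : ℕ → Ω → ℝ}
    (hWm : ∀ i, Measurable (W i)) (hWu : ∀ i, pdf.IsUniform (W i) (Set.Icc 0 1) μ)
    (hWi : iIndepFun W μ) (k : ℕ) :
    ∫⁻ ω, discoveryWeight (fun i => ENNReal.ofReal (W i ω))
        (fun i => ENNReal.ofReal (1 - W i ω)) k 0 ∂μ =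
      ∑' i : ℕ, ENNReal.ofReal (2 / (((i : ℝ) + 1) ^ k * ((i : ℝ) + 2) * ((i : ℝ) + 3))) := by
  rw [eq_tsum_of_recursion (fun k ρ => ∫⁻ ω, discoveryWeight (fun i => ENNReal.ofReal (W i ω))
        (fun i => ENNReal.ofReal (1 - W i ω)) k ρ ∂μ) (fun ρ => by simp [discoveryWeight])
        (lintegral_discoveryWeight_succ hWm hWu hWi) k 0]
  refine tsum_congr fun i => ?_
  congr 1
  have h : ((i + 1 + (0 + 2)).choose (0 + 2) : ℝ) = (i + 3) * (i + 2) / 2 := by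
    rw [Nat.cast_choose_two]
    push_cast
    ring
  rw [invChoose, h]
  push_cast
  field_simp
  ring

/-! ### Sample points covering a finite family of disjoint sets -/

/-- All points `u j` with `j ∈ S` lie in `J 0 ∪ ⋯ ∪ J (k - 1)`, and each of these sets contains
such a point. -/
def IsCovering (J : ℕ → Set ℝ) (u : ℕ → ℝ) (k : ℕ) (S : Finset ℕ) : Prop :=
  (∀ j ∈ S, ∃ i < k, u j ∈ J i) ∧ ∀ i < k, ∃ j ∈ S, u j ∈ J i

/-- The set `R` is forced: it consists of the indices in `S` whose points miss `J k`. It differs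
from `S` exactly because `J k` is hit. -/
lemma isCovering_succ_iff {J : ℕ → Set ℝ} (hJ : Pairwise (Function.onFun Disjoint J)) (u : ℕ → ℝ)
    (k : ℕ) (S : Finset ℕ) :
    IsCovering J u (k + 1) S ↔
      ∃ R ∈ S.powerset, R ≠ S ∧ IsCovering J u k R ∧ ∀ j ∈ S \ R, u j ∈ J k := by
  classical
  have hdis : ∀ {i j x}, x ∈ J i → x ∈ J j → i = j := by
    intro i j x hi hj
    by_contra hne
    exact Set.disjoint_left.1 (hJ hne) hi hj
  constructor
  · rintro ⟨h1, h2⟩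
    refine ⟨S.filter fun j => u j ∉ J k, Finset.mem_powerset.2 (Finset.filter_subset _ _), ?_,
      ⟨?_, ?_⟩, ?_⟩
    · intro h
      obtain ⟨j, hj, hjk⟩ := h2 k (by omega)
      rw [← h] at hj
      exact (Finset.mem_filter.1 hj).2 hjk
    · intro j hj
      obtain ⟨hj, hjk⟩ := Finset.mem_filter.1 hj
      obtain ⟨i, hi, hji⟩ := h1 j hj
      refine ⟨i, ?_, hji⟩
      rcases Nat.lt_succ_iff_lt_or_eq.1 hi with h | rfl
      · exact h
      · exact absurd hji hjk
    · intro i hi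
      obtain ⟨j, hj, hji⟩ := h2 i (by omega)
      refine ⟨j, Finset.mem_filter.2 ⟨hj, fun h => ?_⟩, hji⟩
      have := hdis hji h
      omega
    · intro j hj
      simp only [Finset.mem_sdiff, Finset.mem_filter, not_and, not_not] at hj
      exact hj.2 hj.1
  · rintro ⟨R, hR, hne, ⟨h1, h2⟩, h3⟩
    rw [Finset.mem_powerset] at hR
    constructor
    · intro j hj
      by_cases hjR : j ∈ R
      · obtain ⟨i, hi, h⟩ := h1 j hjR
        exact ⟨i, by omega, h⟩
      · exact ⟨k, by omega, h3 j (Finset.mem_sdiff.2 ⟨hj, hjR⟩)⟩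
    · intro i hi
      rcases Nat.lt_succ_iff_lt_or_eq.1 hi with h | rfl
      · obtain ⟨j, hj, hji⟩ := h2 i h
        exact ⟨j, hR hj, hji⟩
      · obtain ⟨j, hj⟩ := Finset.sdiff_nonempty.2 fun h => hne (hR.antisymm h)
        exact ⟨j, (Finset.mem_sdiff.1 hj).1, h3 j hj⟩

lemma surjWeight_succ_card (p : ℕ → ℝ≥0∞) (k : ℕ) (S : Finset ℕ) :
    surjWeight p (k + 1) S.card = ∑ R ∈ S.powerset,
      if R = S then 0 else p k ^ (S \ R).card * surjWeight p k R.card := by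
  have h : ∀ R ∈ S.powerset, (if R = S then 0 else p k ^ (S \ R).card * surjWeight p k R.card) =
      (fun l => if l < S.card then p k ^ (S.card - l) * surjWeight p k l else 0) R.card := by
    intro R hR
    rw [Finset.mem_powerset] at hR
    by_cases hRS : R = S
    · simp [hRS]
    · have : R.card < S.card := Finset.card_lt_card (hR.ssubset_of_ne hRS)
      simp only [if_neg hRS, if_pos this, Finset.card_sdiff_of_subset hR]
  rw [Finset.sum_congr rfl h, Finset.sum_powerset_apply_card
      (fun l => if l < S.card then p k ^ (S.card - l) * surjWeight p k l else 0), Finset.sum_range_succ]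
  simp only [surjWeight, lt_self_iff_false, if_false, smul_zero, add_zero]
  refine Finset.sum_congr rfl fun l hl => ?_
  rw [if_pos (Finset.mem_range.1 hl), nsmul_eq_mul, mul_assoc]

lemma measurableSet_isCovering {J : ℕ → Set ℝ} (hJm : ∀ i, MeasurableSet (J i)) {U : ℕ → Ω → ℝ}
    (hUm : ∀ j, Measurable (U j)) (k : ℕ) (S : Finset ℕ) :
    MeasurableSet {ω | IsCovering J (fun j => U j ω) k S} := by
  have h : ∀ i j, Measurable fun ω => U j ω ∈ J i := fun i j =>
    (hJm i).mem.comp (hUm j)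
  refine measurableSet_setOfPred.2 (Measurable.and ?_ ?_)
  · refine Measurable.forall fun j => Measurable.imp measurable_const (Measurable.exists fun i => ?_)
    exact Measurable.and measurable_const (h i j)
  · refine Measurable.forall fun i => Measurable.imp measurable_const (Measurable.exists fun j => ?_)
    exact Measurable.and measurable_const (h i j)

/-- The extra constraints `B j` for `j ∈ T` make the induction on `k` close: the points of `S \ R`,
which must lie in `J k`, are moved into `T`. -/
theorem measure_isCovering_inter {J : ℕ → Set ℝ} (hJm : ∀ i, MeasurableSet (J i))
    (hJ : Pairwise (Function.onFun Disjoint J)) {U : ℕ → Ω → ℝ}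
    (hUm : ∀ j, Measurable (U j)) (hUi : iIndepFun U μ) {p : ℕ → ℝ≥0∞}
    (hp : ∀ i j, μ (U j ⁻¹' J i) = p i) (k : ℕ) (S T : Finset ℕ) (hST : Disjoint S T)
    {B : ℕ → Set ℝ} (hB : ∀ j, MeasurableSet (B j)) :
    μ ({ω | IsCovering J (fun j => U j ω) k S} ∩ ⋂ j ∈ T, U j ⁻¹' B j) =
      surjWeight p k S.card * ∏ j ∈ T, μ (U j ⁻¹' B j) := by
  classical
  induction k generalizing S T B with
  | zero =>
    rcases S.eq_empty_or_nonempty with rfl | hS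
    · have : {ω | IsCovering J (fun j => U j ω) 0 ∅} = Set.univ := by
        ext ω; simp [IsCovering]
      rw [this, Set.univ_inter, hUi.measure_inter_preimage_eq_mul T fun i _ => hB i]
      simp [surjWeight]
    · have : {ω | IsCovering J (fun j => U j ω) 0 S} = ∅ := by
        obtain ⟨j, hj⟩ := hS
        refine Set.eq_empty_of_forall_notMem fun ω h => ?_
        obtain ⟨i, hi, -⟩ := h.1 j hj
        omega
      rw [this]
      simp [surjWeight, hS.ne_empty]
  | succ k ih =>
    set E : Finset ℕ → Set Ω := fun R => if R = S then ∅ else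
      {ω | IsCovering J (fun j => U j ω) k R} ∩
        ⋂ j ∈ (S \ R) ∪ T, U j ⁻¹' (if j ∈ T then B j else J k) with hE
    have hB' : ∀ j, MeasurableSet (if j ∈ T then B j else J k) := by
      intro j
      split_ifs
      exacts [hB j, hJm k]
    have hmemE : ∀ R ω, ω ∈ E R ↔ R ≠ S ∧ IsCovering J (fun j => U j ω) k R ∧
        ∀ j ∈ (S \ R) ∪ T, U j ω ∈ if j ∈ T then B j else J k := by
      intro R ω
      simp only [hE]
      by_cases h : R = S
      · simp [h]
      · rw [if_neg h]
        simp only [Set.mem_inter_iff, Set.mem_ofPred_eq, Set.mem_iInter, Set.mem_preimage, ne_eq, h,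
          not_false_eq_true, true_and]
    have hset : {ω | IsCovering J (fun j => U j ω) (k + 1) S} ∩ ⋂ j ∈ T, U j ⁻¹' B j =
        ⋃ R ∈ S.powerset, E R := by
      ext ω
      simp only [Set.mem_inter_iff, Set.mem_ofPred_eq, isCovering_succ_iff hJ, Set.mem_iInter,
        Set.mem_preimage, Set.mem_iUnion, hmemE, exists_prop]
      constructor
      · rintro ⟨⟨R, hR, hne, hc, hk⟩, hT⟩
        refine ⟨R, hR, hne, hc, fun j hj => ?_⟩
        by_cases hjT : j ∈ T
        · rw [if_pos hjT]; exact hT j hjT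
        · rw [if_neg hjT]
          exact hk j ((Finset.mem_union.1 hj).resolve_right hjT)
      · rintro ⟨R, hR, hne, hc, hk⟩
        refine ⟨⟨R, hR, hne, hc, fun j hj => ?_⟩, fun j hj => ?_⟩
        · have := hk j (Finset.mem_union_left _ hj)
          rwa [if_neg (Finset.disjoint_left.1 hST (Finset.mem_sdiff.1 hj).1)] at this
        · have := hk j (Finset.mem_union_right _ hj)
          rwa [if_pos hj] at this
    -- An index in `R \ R'` would have its point both in some `J i` with `i < k` and in `J k`. By
    -- symmetry the events `E R` are disjoint.
    have hsub : ∀ R ∈ S.powerset, ∀ R' ∈ S.powerset, ∀ ω, ω ∈ E R → ω ∈ E R' → R ⊆ R' := by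
      intro R hR R' hR' ω h h' j hj
      by_contra hj'
      rw [Finset.mem_powerset] at hR
      obtain ⟨-, hc, -⟩ := (hmemE _ _).1 h
      obtain ⟨-, -, hk⟩ := (hmemE _ _).1 h'
      obtain ⟨i, hi, hji⟩ := hc.1 j hj
      have := hk j (Finset.mem_union_left _ (Finset.mem_sdiff.2 ⟨hR hj, hj'⟩))
      rw [if_neg (Finset.disjoint_left.1 hST (hR hj))] at this
      exact Set.disjoint_left.1 (hJ hi.ne) hji this
    have hpd : Set.PairwiseDisjoint (↑S.powerset) E := by
      intro R hR R' hR' hne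
      refine Set.disjoint_left.2 fun ω h h' => hne ?_
      exact (hsub R hR R' hR' ω h h').antisymm (hsub R' hR' R hR ω h' h)
    have hEm : ∀ R ∈ S.powerset, MeasurableSet (E R) := by
      intro R _
      simp only [hE]
      split_ifs
      · exact MeasurableSet.empty
      · exact (measurableSet_isCovering hJm hUm k R).inter
          (Finset.measurableSet_biInter _ fun j _ => hUm j (hB' j))
    rw [hset, measure_biUnion_finset hpd hEm, surjWeight_succ_card, Finset.sum_mul]
    refine Finset.sum_congr rfl fun R hR => ?_
    rw [Finset.mem_powerset] at hR
    simp only [hE]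
    split_ifs with hRS
    · simp
    · have hdT : Disjoint (S \ R) T := hST.mono_left Finset.sdiff_subset
      rw [ih R ((S \ R) ∪ T) (Finset.disjoint_union_right.2
        ⟨Finset.disjoint_sdiff, hST.mono_left hR⟩) hB', Finset.prod_union hdT]
      have h1 : ∏ j ∈ S \ R, μ (U j ⁻¹' if j ∈ T then B j else J k) = p k ^ (S \ R).card := by
        rw [← Finset.prod_const]
        refine Finset.prod_congr rfl fun j hj => ?_
        rw [if_neg (Finset.disjoint_left.1 hdT hj), hp]
      have h2 : ∏ j ∈ T, μ (U j ⁻¹' if j ∈ T then B j else J k) = ∏ j ∈ T, μ (U j ⁻¹' B j) :=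
        Finset.prod_congr rfl fun j hj => by rw [if_pos hj]
      rw [h1, h2]
      ring

/-- Each of `J 0, …, J (k - 1)` contains a point of the sequence `u` that comes before all points
outside `A`. -/
def IsDiscovering (J : ℕ → Set ℝ) (A : Set ℝ) (u : ℕ → ℝ) (k : ℕ) : Prop :=
  ∀ i < k, ∃ j : ℕ, (∀ n ≤ j, u n ∈ A) ∧ u j ∈ J i

theorem measure_isDiscovering [IsProbabilityMeasure μ] {J : ℕ → Set ℝ}
    (hJm : ∀ i, MeasurableSet (J i)) (hJ : Pairwise (Function.onFun Disjoint J)) {U : ℕ → Ω → ℝ}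
    (hUm : ∀ j, Measurable (U j)) (hUi : iIndepFun U μ) {p : ℕ → ℝ≥0∞}
    (hp : ∀ i j, μ (U j ⁻¹' J i) = p i) (k : ℕ) {A : Set ℝ} (hA : A = ⋃ i ∈ Finset.range k, J i)
    {q : ℝ≥0∞} (hq : ∀ j, μ (U j ⁻¹' Aᶜ) = q) (hq0 : q ≠ 0) :
    μ {ω | IsDiscovering J A (fun j => U j ω) k} = q * ∑' n, surjWeight p k n := by
  have hmemA : ∀ x, x ∈ A ↔ ∃ i < k, x ∈ J i := by
    intro x; simp [hA]
  have hAm : MeasurableSet A := by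
    rw [hA]; exact Finset.measurableSet_biUnion _ fun i _ => hJm i
  -- `F n`: the first exit occurs at draw `n`, and the draws before it cover all `k` sets.
  set F : ℕ → Set Ω := fun n =>
    {ω | IsCovering J (fun j => U j ω) k (Finset.range n)} ∩ ⋂ j ∈ ({n} : Finset ℕ), U j ⁻¹' Aᶜ
    with hF
  have hmemF : ∀ n ω, ω ∈ F n ↔ (∀ j < n, U j ω ∈ A) ∧ (∀ i < k, ∃ j < n, U j ω ∈ J i) ∧
      U n ω ∉ A := by
    intro n ω
    simp [hF, IsCovering, hmemA, and_assoc]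
  have hFm : ∀ n, MeasurableSet (F n) := fun n =>
    (measurableSet_isCovering hJm hUm k _).inter
      (Finset.measurableSet_biInter _ fun j _ => hUm j hAm.compl)
  have hFd : Pairwise (Function.onFun Disjoint F) := by
    intro n n' hne
    refine Set.disjoint_left.2 fun ω h h' => ?_
    rw [hmemF] at h h'
    rcases lt_or_gt_of_ne hne with h1 | h1
    · exact h.2.2 (h'.1 n h1)
    · exact h'.2.2 (h.1 n' h1)
  have hμF : ∀ n, μ (F n) = q * surjWeight p k n := by
    intro n
    rw [hF, measure_isCovering_inter hJm hJ hUm hUi hp k _ _ (by simp) (B := fun _ => Aᶜ)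
      fun _ => hAm.compl]
    rw [Finset.prod_singleton, hq, Finset.card_range, mul_comm]
  -- Discovery is also possible on paths that never leave `A`, which belong to no `F n`; they are
  -- null because `q ≠ 0`.
  have hnull : ∀ᵐ ω ∂μ, ∃ n, U n ω ∉ A := by
    have hq1 : μ (U 0 ⁻¹' A) = 1 - q := by
      rw [← hq 0, Set.preimage_compl, prob_compl_eq_one_sub (hUm 0 hAm),
        ENNReal.sub_sub_cancel ENNReal.one_ne_top prob_le_one]
    have hlt : 1 - q < 1 := ENNReal.sub_lt_self ENNReal.one_ne_top one_ne_zero hq0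
    have hle : ∀ N : ℕ, μ {ω | ¬ ∃ n, U n ω ∉ A} ≤ (1 - q) ^ N := by
      intro N
      calc μ {ω | ¬ ∃ n, U n ω ∉ A} ≤ μ (⋂ j ∈ Finset.range N, U j ⁻¹' A) := by
            refine measure_mono fun ω hω => ?_
            simp only [Set.mem_ofPred_eq, not_exists, not_not] at hω
            simpa using fun j _ => hω j
        _ = ∏ j ∈ Finset.range N, μ (U j ⁻¹' A) :=
            hUi.measure_inter_preimage_eq_mul _ fun _ _ => hAm
        _ = (1 - q) ^ N := by
            rw [← Finset.card_range N, ← Finset.prod_const, Finset.card_range]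
            refine Finset.prod_congr rfl fun j _ => ?_
            have := prob_compl_eq_one_sub (μ := μ) (hUm j hAm.compl)
            rwa [← Set.preimage_compl, compl_compl, hq] at this
    rw [ae_iff]
    exact le_antisymm (ge_of_tendsto' (ENNReal.tendsto_pow_atTop_nhds_zero_of_lt_one hlt) hle)
      bot_le
  have hae : {ω | IsDiscovering J A (fun j => U j ω) k} =ᵐ[μ] ⋃ n, F n := by
    filter_upwards [hnull] with ω hω
    refine propext ?_
    change IsDiscovering J A (fun j => U j ω) k ↔ ω ∈ ⋃ n, F n
    simp only [Set.mem_iUnion, hmemF]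
    constructor
    · intro h
      classical
      refine ⟨Nat.find hω, fun j hj => not_not.1 (Nat.find_min hω hj), fun i hi => ?_,
        Nat.find_spec hω⟩
      obtain ⟨j, hj, hji⟩ := h i hi
      refine ⟨j, ?_, hji⟩
      by_contra hle
      exact Nat.find_spec hω (hj _ (not_lt.1 hle))
    · rintro ⟨n, h1, h2, -⟩ i hi
      obtain ⟨j, hj, hji⟩ := h2 i hi
      exact ⟨j, fun m hm => h1 m (by omega), hji⟩
  rw [measure_congr hae, measure_iUnion hFd hFm, ← ENNReal.tsum_mul_left]
  exact tsum_congr hμF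

/-! ### The discovery event for stick-breaking -/

/-- The interval with number `i` cut out by the lengths `p 0, p 1, …`. -/
def consecutiveInterval (p : ℕ → ℝ) (i : ℕ) : Set ℝ :=
  Set.Ico (∑ j ∈ Finset.range i, p j) (∑ j ∈ Finset.range (i + 1), p j)

lemma natCast_lt_iInf_iff (u : ℕ → ℝ) (A : Set ℝ) (j : ℕ) :
    (j : ℕ∞) < (⨅ (n : ℕ) (_ : u n ∉ A), (n : ℕ∞)) ↔ ∀ n ≤ j, u n ∈ A := by
  constructor
  · intro h n hn
    by_contra hA
    have h1 : (⨅ (n : ℕ) (_ : u n ∉ A), (n : ℕ∞)) ≤ n := iInf₂_le n hA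
    have h2 := h.trans_le h1
    rw [Nat.cast_lt] at h2
    omega
  · intro h
    refine (Nat.cast_lt.2 j.lt_succ_self).trans_le (le_iInf₂ fun n hn => ?_)
    rw [Nat.cast_le]
    by_contra hlt
    exact hn (h n (by omega))

/-- The event depends on `W` only through the stick lengths, and independence from `U` is assumed
only for these. -/
lemma mem_discoveryEvent_iff {Ω : Type*} (W U : ℕ → Ω → ℝ) (k : ℕ) (ω : Ω) :
    ω ∈ discoveryEvent W U k ↔
      IsDiscovering (consecutiveInterval fun i => stickLength W i ω)
        (Set.Ico 0 (∑ i ∈ Finset.range k, stickLength W i ω)) (fun j => U j ω) k := by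
  simp only [discoveryEvent, IsDiscovering, exitTime, natCast_lt_iInf_iff, stickInterval, stickEnd,
    consecutiveInterval, Set.mem_ofPred_eq]

lemma measurableSet_isDiscovering (k : ℕ) :
    MeasurableSet {z : (ℕ → ℝ) × (ℕ → ℝ) | IsDiscovering (consecutiveInterval z.1)
      (Set.Ico 0 (∑ i ∈ Finset.range k, z.1 i)) z.2 k} := by
  have hR : ∀ i, Measurable fun z : (ℕ → ℝ) × (ℕ → ℝ) => ∑ j ∈ Finset.range i, z.1 j := by
    intro i; fun_prop
  have hu : ∀ j, Measurable fun z : (ℕ → ℝ) × (ℕ → ℝ) => z.2 j := by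
    intro j; fun_prop
  simp only [IsDiscovering, consecutiveInterval, Set.mem_Ico]
  refine measurableSet_setOfPred.2 (Measurable.forall fun i => Measurable.imp measurable_const
    (Measurable.exists fun j => Measurable.and (Measurable.forall fun n =>
      Measurable.imp measurable_const (Measurable.and ?_ ?_)) (Measurable.and ?_ ?_)))
  · exact measurableSet_setOfPred.1 (measurableSet_le measurable_const (hu n))
  · exact measurableSet_setOfPred.1 (measurableSet_lt (hu n) (hR k))
  · exact measurableSet_setOfPred.1 (measurableSet_le (hR i) (hu j))
  · exact measurableSet_setOfPred.1 (measurableSet_lt (hu j) (hR (i + 1)))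

lemma sum_stickLength {Ω : Type*} (W : ℕ → Ω → ℝ) (k : ℕ) (ω : Ω) :
    ∑ i ∈ Finset.range k, stickLength W i ω = 1 - ∏ i ∈ Finset.range k, (1 - W i ω) := by
  induction k with
  | zero => simp
  | succ k ih =>
    rw [Finset.sum_range_succ, ih, Finset.prod_range_succ, stickLength]
    ring

lemma iUnion_Ico_of_monotone {R : ℕ → ℝ} (hR : Monotone R) (k : ℕ) :
    Set.Ico (R 0) (R k) = ⋃ i ∈ Finset.range k, Set.Ico (R i) (R (i + 1)) := by
  induction k with
  | zero => simp
  | succ k ih =>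
    rw [Finset.range_add_one, Finset.set_biUnion_insert, ← ih, Set.union_comm,
      Set.Ico_union_Ico_eq_Ico (hR (Nat.zero_le k)) (hR k.le_succ)]

/-- The conditional probability of the discovery event given the sticks. -/
lemma measure_isDiscovering_sticks [IsProbabilityMeasure μ] {w : ℕ → ℝ}
    (hw : ∀ i, w i ∈ Set.Ico (0 : ℝ) 1) {U : ℕ → Ω → ℝ} (hUm : ∀ j, Measurable (U j))
    (hUu : ∀ j, pdf.IsUniform (U j) (Set.Icc 0 1) μ) (hUi : iIndepFun U μ) (k : ℕ) :
    μ {ω | IsDiscovering (consecutiveInterval fun i => (∏ j ∈ Finset.range i, (1 - w j)) * w i)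
        (Set.Ico 0 (∑ i ∈ Finset.range k, (∏ j ∈ Finset.range i, (1 - w j)) * w i))
        (fun j => U j ω) k} =
      discoveryWeight (fun i => ENNReal.ofReal (w i)) (fun i => ENNReal.ofReal (1 - w i)) k 0 := by
  set p : ℕ → ℝ := fun i => (∏ j ∈ Finset.range i, (1 - w j)) * w i with hp
  set Q : ℕ → ℝ := fun k => ∏ j ∈ Finset.range k, (1 - w j) with hQ
  set R : ℕ → ℝ := fun k => ∑ i ∈ Finset.range k, p i with hR
  -- The strict bound `w j < 1` makes the exit probability positive, as `measure_isDiscovering`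
  -- needs.
  have hQ0 : ∀ k, 0 < Q k := fun k => Finset.prod_pos fun j _ => sub_pos.2 (hw j).2
  have hp0 : ∀ i, 0 ≤ p i := fun i => mul_nonneg (hQ0 i).le (hw i).1
  have hRQ : ∀ k, R k = 1 - Q k := fun k => sum_stickLength (fun i (_ : Unit) => w i) k ()
  have hRm : Monotone R := monotone_nat_of_le_succ fun n => by
    simp only [hR, Finset.sum_range_succ]
    linarith [hp0 n]
  have hR00 : R 0 = 0 := by simp [hR]
  have hR0 : ∀ k, 0 ≤ R k := fun k => hR00 ▸ hRm (Nat.zero_le k)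
  have hR1 : ∀ k, R k ≤ 1 := fun k => by linarith [hRQ k, hQ0 k]
  have hμ : ∀ a b j, 0 ≤ a → b ≤ 1 → μ (U j ⁻¹' Set.Ico a b) = ENNReal.ofReal (b - a) := by
    intro a b j ha hb
    rw [measure_preimage_of_isUniform (hUm j) (hUu j) measurableSet_Ico,
      Set.inter_eq_self_of_subset_left, Real.volume_Ico]
    exact fun x hx => ⟨ha.trans hx.1, hx.2.le.trans hb⟩
  have hlen : ∀ i j, μ (U j ⁻¹' consecutiveInterval p i) = ENNReal.ofReal (p i) := by
    intro i j
    rw [consecutiveInterval, hμ _ _ _ (hR0 i) (hR1 (i + 1))]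
    congr 1
    simp only [hR, Finset.sum_range_succ]
    ring
  have hout : ∀ j, μ (U j ⁻¹' (Set.Ico 0 (R k))ᶜ) = ENNReal.ofReal (Q k) := by
    intro j
    rw [Set.preimage_compl, prob_compl_eq_one_sub (hUm j measurableSet_Ico),
      hμ _ _ _ le_rfl (hR1 k), ← ENNReal.ofReal_one, ← ENNReal.ofReal_sub _ (by linarith [hR0 k])]
    congr 1
    rw [hRQ]
    ring
  have hunion : Set.Ico 0 (R k) = ⋃ i ∈ Finset.range k, consecutiveInterval p i := by
    conv_lhs => rw [← hR00]
    exact iUnion_Ico_of_monotone hRm k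
  rw [measure_isDiscovering (J := consecutiveInterval p) (fun i => measurableSet_Ico)
    hRm.pairwise_disjoint_on_Ico_succ hUm hUi hlen k hunion hout
    (ENNReal.ofReal_pos.2 (hQ0 k)).ne', discoveryWeight_eq _ _ (fun i => ENNReal.ofReal (p i))]
  · simp only [Nat.add_zero, Nat.choose_self, Nat.cast_one, one_mul, zero_add, pow_one]
    rw [hQ, ENNReal.ofReal_prod_of_nonneg fun j _ => (sub_pos.2 (hw j).2).le]
  · intro i
    rw [hp, ENNReal.ofReal_mul (hQ0 i).le, hQ,
      ENNReal.ofReal_prod_of_nonneg fun j _ => (sub_pos.2 (hw j).2).le]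

/-- By independence the joint law of lengths and points is a product measure, so Tonelli reduces the
probability to the average of the conditional one for fixed sticks. -/
theorem measure_discoveryEvent [IsProbabilityMeasure μ] {W U : ℕ → Ω → ℝ}
    (hWm : ∀ i, Measurable (W i)) (hUm : ∀ j, Measurable (U j))
    (hWu : ∀ i, pdf.IsUniform (W i) (Set.Icc 0 1) μ)
    (hUu : ∀ j, pdf.IsUniform (U j) (Set.Icc 0 1) μ)
    (hWi : iIndepFun W μ) (hUi : iIndepFun U μ)
    (hWU : IndepFun (fun ω i => stickLength W i ω) (fun ω j => U j ω) μ) (k : ℕ) :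
    μ (discoveryEvent W U k) =
      ∑' i : ℕ, ENNReal.ofReal (2 / (((i : ℝ) + 1) ^ k * ((i : ℝ) + 2) * ((i : ℝ) + 3))) := by
  have hPm : Measurable fun ω i => stickLength W i ω := by
    refine measurable_pi_lambda _ fun i => ?_
    exact (Finset.measurable_prod _ fun j _ => (hWm j).const_sub 1).mul (hWm i)
  have hUm' : Measurable fun ω j => U j ω := measurable_pi_lambda _ hUm
  have hE := measurableSet_isDiscovering k
  have hev : discoveryEvent W U k = (fun ω => ((fun i => stickLength W i ω), fun j => U j ω)) ⁻¹'
      {z : (ℕ → ℝ) × (ℕ → ℝ) | IsDiscovering (consecutiveInterval z.1)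
        (Set.Ico 0 (∑ i ∈ Finset.range k, z.1 i)) z.2 k} := by
    ext ω
    exact mem_discoveryEvent_iff W U k ω
  rw [hev, ← Measure.map_apply (hPm.prodMk hUm') hE,
    (indepFun_iff_map_prod_eq_prod_map_map hPm.aemeasurable hUm'.aemeasurable).1 hWU,
    Measure.prod_apply hE, lintegral_map (measurable_measure_prodMk_left hE) hPm,
    ← lintegral_discoveryWeight hWm hWu hWi k]
  refine lintegral_congr_ae ?_
  filter_upwards [ae_all_iff.2 fun i => ae_mem_Ico_of_isUniform (hWm i) (hWu i)] with ω hω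
  rw [← measure_isDiscovering_sticks hω hUm hUu hUi k,
    Measure.map_apply hUm' (measurable_prodMk_left hE)]
  rfl

theorem hasSum_renewalProb [IsProbabilityMeasure μ] {W U : ℕ → Ω → ℝ}
    (hWm : ∀ i, Measurable (W i)) (hUm : ∀ j, Measurable (U j))
    (hWu : ∀ i, pdf.IsUniform (W i) (Set.Icc 0 1) μ)
    (hUu : ∀ j, pdf.IsUniform (U j) (Set.Icc 0 1) μ)
    (hWi : iIndepFun W μ) (hUi : iIndepFun U μ)
    (hWU : IndepFun (fun ω i => stickLength W i ω) (fun ω j => U j ω) μ) (k : ℕ) :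
    HasSum (fun i : ℕ => 2 / (((i : ℝ) + 1) ^ k * ((i : ℝ) + 2) * ((i : ℝ) + 3)))
      (renewalProb μ W U k) := by
  have h := measure_discoveryEvent hWm hUm hWu hUu hWi hUi hWU k
  have hu : renewalProb μ W U k = μ.real (discoveryEvent W U k) := by
    cases k with
    | zero => simp [renewalProb, discoveryEvent]
    | succ k => rfl
  have hnn : ∀ i : ℕ, 0 ≤ 2 / (((i : ℝ) + 1) ^ k * ((i : ℝ) + 2) * ((i : ℝ) + 3)) :=
    fun i => by positivity
  have hne := measure_ne_top μ (discoveryEvent W U k)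
  rw [h] at hne
  rw [hu, Measure.real, h]
  convert ENNReal.hasSum_toReal hne using 2 with i
  · rw [ENNReal.toReal_ofReal (hnn i)]
  · rw [ENNReal.tsum_toReal_eq fun i => ENNReal.ofReal_ne_top]

/-! ### Kaluza's theorem -/

/-- The solution of the renewal equation `u (n + 1) = ∑ i ≤ n, f (i + 1) * u (n - i)` with `f 0 = 0`
(for `u 0 = 1`). -/
def renewalIncrement (u : ℕ → ℝ) : ℕ → ℝ
  | 0 => 0
  | n + 1 => u (n + 1) - ∑ i : Fin n, renewalIncrement u (i + 1) * u (n - i)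

lemma renewalIncrement_succ (u : ℕ → ℝ) (n : ℕ) :
    renewalIncrement u (n + 1) =
      u (n + 1) - ∑ i ∈ Finset.range n, renewalIncrement u (i + 1) * u (n - i) := by
  rw [renewalIncrement, Fin.sum_univ_eq_sum_range (fun i => renewalIncrement u (i + 1) * u (n - i))]

lemma renewal_equation {u : ℕ → ℝ} (h0 : u 0 = 1) (n : ℕ) :
    u (n + 1) = ∑ i ∈ Finset.range (n + 1), renewalIncrement u (i + 1) * u (n - i) := by
  rw [Finset.sum_range_succ, renewalIncrement_succ, Nat.sub_self, h0]
  ring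

/-- Log-convexity means that the ratios `u (n+1) / u n` are nondecreasing; this compares the ratios
at `a` and `a + d`. -/
lemma mul_le_mul_of_logConvex {u : ℕ → ℝ} (hpos : ∀ n, 0 < u n)
    (hconv : ∀ n, u (n + 1) * u (n + 1) ≤ u n * u (n + 2)) (a d : ℕ) :
    u (a + 1) * u (a + d) ≤ u a * u (a + d + 1) := by
  induction d with
  | zero => rw [add_zero, mul_comm]
  | succ d ih =>
    refine le_of_mul_le_mul_right ?_ (hpos (a + d + 1))
    rw [← add_assoc]
    calc u (a + 1) * u (a + d + 1) * u (a + d + 1)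
        = u (a + 1) * (u (a + d + 1) * u (a + d + 1)) := by ring
      _ ≤ u (a + 1) * (u (a + d) * u (a + d + 2)) :=
          mul_le_mul_of_nonneg_left (hconv _) (hpos _).le
      _ = u (a + 1) * u (a + d) * u (a + d + 2) := by ring
      _ ≤ u a * u (a + d + 1) * u (a + d + 2) := mul_le_mul_of_nonneg_right ih (hpos _).le
      _ = u a * u (a + d + 1 + 1) * u (a + d + 1) := by ring

lemma renewalIncrement_nonneg {u : ℕ → ℝ} (h0 : u 0 = 1) (hpos : ∀ n, 0 < u n)
    (hconv : ∀ n, u (n + 1) * u (n + 1) ≤ u n * u (n + 2)) (n : ℕ) :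
    0 ≤ renewalIncrement u n := by
  induction n using Nat.strong_induction_on with
  | _ n ih =>
    rcases n with _ | _ | m
    · simp [renewalIncrement]
    · rw [renewalIncrement_succ]
      simpa using (hpos 1).le
    · rw [renewalIncrement_succ, sub_nonneg]
      -- After multiplication by `u (m+1)`, the renewal equation expands that factor on the right,
      -- and the two sums compare term by term.
      refine le_of_mul_le_mul_left ?_ (hpos (m + 1))
      rw [Finset.mul_sum]
      conv_rhs => rw [renewal_equation h0 m, Finset.sum_mul]
      refine Finset.sum_le_sum fun i hi => ?_
      have hi' := Finset.mem_range.1 hi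
      have h := mul_le_mul_of_logConvex hpos hconv (m - i) (i + 1)
      rw [show m - i + (i + 1) = m + 1 by omega, show m - i + 1 = m + 1 - i by omega] at h
      calc u (m + 1) * (renewalIncrement u (i + 1) * u (m + 1 - i))
          = renewalIncrement u (i + 1) * (u (m + 1 - i) * u (m + 1)) := by ring
        _ ≤ renewalIncrement u (i + 1) * (u (m - i) * u (m + 1 + 1)) :=
            mul_le_mul_of_nonneg_left h (ih (i + 1) (by omega))
        _ = _ := by ring

/-- Kaluza's theorem for nonincreasing sequences. -/
theorem isRenewalSequence_of_logConvex {u : ℕ → ℝ} (h0 : u 0 = 1) (hpos : ∀ n, 0 < u n)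
    (hanti : Antitone u) (hconv : ∀ n, u (n + 1) * u (n + 1) ≤ u n * u (n + 2)) :
    IsRenewalSequence u := by
  have hf := renewalIncrement_nonneg h0 hpos hconv
  have hsum : ∀ n, ∑ i ∈ Finset.range n, renewalIncrement u (i + 1) ≤ 1 := by
    intro n
    rcases n with _ | n
    · simp
    · refine le_of_mul_le_mul_right ?_ (hpos (n + 1))
      rw [one_mul, Finset.sum_mul]
      conv_rhs => rw [renewal_equation h0 n]
      exact Finset.sum_le_sum fun i _ =>
        mul_le_mul_of_nonneg_left (hanti (by omega)) (hf _)
  refine ⟨h0, renewalIncrement u, hf, summable_of_sum_range_le (fun k => hf (k + 1)) hsum,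
    Real.tsum_le_of_sum_range_le (fun k => hf (k + 1)) hsum, fun k hk => ?_⟩
  obtain ⟨n, rfl⟩ : ∃ n, k = n + 1 := ⟨k - 1, by omega⟩
  rw [renewal_equation h0 n, ← Finset.Ico_add_one_right_eq_Icc, Finset.sum_Ico_eq_sum_range]
  refine Finset.sum_congr (by simp) fun i _ => ?_
  rw [add_comm 1 i, Nat.add_sub_add_right]

/-! ### Properties of the positive series -/

/-- The series of `PositiveSeries`, with summation index starting at `0`. -/
def ShiftedSeries (s : ℕ → ℝ) : Prop :=
  ∀ k : ℕ, HasSum (fun i : ℕ => 2 / (((i : ℝ) + 1) ^ k * ((i : ℝ) + 2) * ((i : ℝ) + 3))) (s k)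

lemma series_pos {s : ℕ → ℝ} (hs : ShiftedSeries s) (k : ℕ) : 0 < s k :=
  (hs k).tsum_eq ▸ (hs k).summable.tsum_pos (fun i => by positivity) 0 (by positivity)

lemma series_antitone {s : ℕ → ℝ} (hs : ShiftedSeries s) : Antitone s := antitone_nat_of_succ_le fun k => by
  refine hasSum_le (fun i => ?_) (hs (k + 1)) (hs k)
  have h1 : (1 : ℝ) ≤ i + 1 := by simp
  gcongr
  exacts [k.le_succ]

/-- Cauchy–Schwarz for moments: the sum of the nonnegative terms `c_i x_i^k (x_i - t)²`, with `x_i =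
1/(i+1)` and `c_i = 2/((i+2)(i+3))`, is evaluated at its minimizer `t = s (k+1) / s k`. -/
lemma series_logConvex {s : ℕ → ℝ} (hs : ShiftedSeries s) (k : ℕ) : s (k + 1) * s (k + 1) ≤ s k * s (k + 2) := by
  have h0 := series_pos hs k
  set t := s (k + 1) / s k with ht
  have h := ((hs (k + 2)).sub ((hs (k + 1)).mul_left (2 * t))).add ((hs k).mul_left (t ^ 2))
  have hnn := h.nonneg fun i => by
    have e : 2 / (((i : ℝ) + 1) ^ (k + 2) * ((i : ℝ) + 2) * ((i : ℝ) + 3)) -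
        2 * t * (2 / (((i : ℝ) + 1) ^ (k + 1) * ((i : ℝ) + 2) * ((i : ℝ) + 3))) +
        t ^ 2 * (2 / (((i : ℝ) + 1) ^ k * ((i : ℝ) + 2) * ((i : ℝ) + 3))) =
        2 / (((i : ℝ) + 1) ^ (k + 2) * ((i : ℝ) + 2) * ((i : ℝ) + 3)) *
          (1 - t * (i + 1)) ^ 2 := by
      field_simp
      ring
    rw [e]
    positivity
  have e : s (k + 2) - 2 * t * s (k + 1) + t ^ 2 * s k =
      (s k * s (k + 2) - s (k + 1) * s (k + 1)) / s k := by
    rw [ht]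
    field_simp
    ring
  rw [e, le_div_iff₀ h0, zero_mul, sub_nonneg] at hnn
  exact hnn

lemma series_zero {s : ℕ → ℝ} (hs : ShiftedSeries s) : s 0 = 1 := by
  have h := hasSum_invChoose 0
  refine (hs 0).unique ?_
  suffices hf : ∀ i : ℕ, 2 / (((i : ℝ) + 1) ^ 0 * ((i : ℝ) + 2) * ((i : ℝ) + 3)) =
      invChoose (0 + 2) (i + 1) by
    simpa only [hf, Nat.cast_zero, zero_add, div_one] using h
  intro i
  have h : ((i + 1 + (0 + 2)).choose (0 + 2) : ℝ) = (i + 3) * (i + 2) / 2 := by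
    rw [Nat.cast_choose_two]
    push_cast
    ring
  rw [invChoose, h]
  field_simp

lemma series_one {s : ℕ → ℝ} (hs : ShiftedSeries s) : s 1 = 1 / 2 := by
  refine (hs 1).unique ?_
  rw [hasSum_iff_tendsto_nat_of_nonneg fun i => by positivity]
  -- Telescoping: `2/(j(j+1)(j+2)) = 1/(j(j+1)) - 1/((j+1)(j+2))`.
  have h : ∀ n, ∑ i ∈ Finset.range n, 2 / (((i : ℝ) + 1) ^ 1 * ((i : ℝ) + 2) * ((i : ℝ) + 3)) =
      1 / 2 - 1 / ((n : ℝ) + 1) * (1 / ((n + 1 : ℕ) + 1)) := by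
    intro n
    induction n with
    | zero => norm_num
    | succ n ih =>
      rw [Finset.sum_range_succ, ih]
      push_cast
      field_simp
      ring
  simp_rw [h]
  have ht := tendsto_one_div_add_atTop_nhds_zero_nat (𝕜 := ℝ)
  simpa using (ht.mul (ht.comp (tendsto_add_atTop_nat 1))).const_sub (1 / 2 : ℝ)

lemma series_isRenewalSequence {s : ℕ → ℝ} (hs : ShiftedSeries s) : IsRenewalSequence s :=
  isRenewalSequence_of_logConvex (series_zero hs) (series_pos hs) (series_antitone hs)
    (series_logConvex hs)

lemma series_tendsto {s : ℕ → ℝ} (hs : ShiftedSeries s) : Tendsto s atTop (𝓝 (1 / 3)) := by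
  have h := tendsto_tsum_of_dominated_convergence (𝓕 := atTop)
    (f := fun (k : ℕ) (i : ℕ) => 2 / (((i : ℝ) + 1) ^ k * ((i : ℝ) + 2) * ((i : ℝ) + 3)))
    (g := fun i => if i = 0 then (1 / 3 : ℝ) else 0) (hs 0).summable ?_ ?_
  · simpa only [(hs _).tsum_eq, tsum_ite_eq] using h
  · intro i
    rcases i with _ | i
    · norm_num
    · have hx : (((i + 1 : ℕ) : ℝ) + 1)⁻¹ < 1 := inv_lt_one_of_one_lt₀ (by push_cast; linarith)
      have h := (tendsto_pow_atTop_nhds_zero_of_lt_one (by positivity) hx).mul_const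
        (2 / ((((i + 1 : ℕ) : ℝ) + 2) * (((i + 1 : ℕ) : ℝ) + 3)))
      rw [zero_mul] at h
      simp only [Nat.add_eq_zero_iff, one_ne_zero, and_false, if_false]
      refine h.congr fun k => ?_
      rw [inv_pow]
      field_simp
  · refine Eventually.of_forall fun k i => ?_
    rw [Real.norm_of_nonneg (by positivity)]
    have h1 : (1 : ℝ) ≤ i + 1 := by simp
    gcongr
    exacts [k.zero_le]

lemma series_recursion {s : ℕ → ℝ} (hs : ShiftedSeries s) : ZetaRecursion s := by
  refine ⟨series_zero hs, series_one hs, fun k hk => ?_⟩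
  obtain ⟨n, rfl⟩ : ∃ n, k = n + 2 := ⟨k - 2, by omega⟩
  have hz : HasSum (fun i : ℕ => 2 * (1 / ((i : ℝ) + 1) ^ (n + 2)))
      (2 * s (n + 2) + 3 * s (n + 1) + s n) := by
    have h := (((((hs (n + 2)).mul_left 2).add ((hs (n + 1)).mul_left 3)).add (hs n)))
    have e : ∀ i : ℕ, 2 * (1 / ((i : ℝ) + 1) ^ (n + 2)) =
        2 * (2 / (((i : ℝ) + 1) ^ (n + 2) * ((i : ℝ) + 2) * ((i : ℝ) + 3))) +
        3 * (2 / (((i : ℝ) + 1) ^ (n + 1) * ((i : ℝ) + 2) * ((i : ℝ) + 3))) +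
        2 / (((i : ℝ) + 1) ^ n * ((i : ℝ) + 2) * ((i : ℝ) + 3)) := by
      intro i
      field_simp
      ring
    simpa only [e] using h
  have hc := Complex.hasSum_ofReal.2 hz
  have hζ := zeta_eq_tsum_one_div_nat_add_one_cpow (s := ((n + 2 : ℕ) : ℂ)) (by simp; linarith)
  rw [hζ, ← tsum_mul_left]
  simp only [Complex.cpow_natCast]
  rw [show n + 2 - 1 = n + 1 by omega, Nat.add_sub_cancel]
  push_cast at hc
  exact hc.tsum_eq.symm

lemma series_positiveSeries {s : ℕ → ℝ} (hs : ShiftedSeries s) : PositiveSeries s := by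
  intro k
  rw [← Equiv.pnatEquivNat.symm.hasSum_iff]
  convert hs k using 2 with i
  simp
  ring

/-! ### Solving the zeta recursion -/

lemma eq_of_linear_recursion {a b : ℕ → ℂ} (h0 : a 0 = b 0) (h1 : a 1 = b 1)
    (h : ∀ k, 2 * a (k + 2) + 3 * a (k + 1) + a k = 2 * b (k + 2) + 3 * b (k + 1) + b k) :
    a = b := by
  have : ∀ k, a k = b k ∧ a (k + 1) = b (k + 1) := by
    intro k
    induction k with
    | zero => exact ⟨h0, h1⟩
    | succ k ih =>
      refine ⟨ih.2, ?_⟩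
      have := h k
      rw [ih.1, ih.2] at this
      linear_combination this / 2
  exact funext fun k => (this k).1

/-- The explicit solution of the recursion. -/
def zetaCombinationValue (k : ℕ) : ℂ :=
  (-1 : ℂ) ^ ((k : ℤ) - 1) * (2 - 3 / 2 ^ k) +
    ∑ j ∈ Finset.Icc 2 k, (-1 : ℂ) ^ (k - j) * (2 - 1 / 2 ^ (k - j)) * riemannZeta (j : ℂ)

lemma zetaCombinationValue_eq (k : ℕ) : zetaCombinationValue k =
    -(-1 : ℂ) ^ k * (2 - 3 / 2 ^ k) +
      ∑ j ∈ Finset.Icc 2 k, (-1 : ℂ) ^ (k - j) * (2 - 1 / 2 ^ (k - j)) * riemannZeta (j : ℂ) := by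
  rw [zetaCombinationValue, zpow_sub₀ (by norm_num), zpow_natCast, zpow_one, div_neg, div_one]

/-- The characteristic roots are `-1` and `-1/2`. The coefficient `(-1)^d (2 - 2^(-d))` is the
homogeneous solution with values `1, -3/2` at `d = 0, 1`, so it carries the forcing term; the part
without zeta values is the homogeneous solution starting with `1, 1/2`. -/
lemma zetaCombinationValue_recursion (k : ℕ) :
    2 * zetaCombinationValue (k + 2) + 3 * zetaCombinationValue (k + 1) + zetaCombinationValue k =
      2 * riemannZeta ((k + 2 : ℕ) : ℂ) := by
  simp only [zetaCombinationValue_eq]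
  rw [Finset.sum_Icc_succ_top (show 2 ≤ k + 1 + 1 by omega)]
  rcases k with _ | k
  · norm_num
    ring
  · have e1 := Finset.sum_Icc_succ_top (show 2 ≤ k + 1 + 1 by omega)
      fun j => (-1 : ℂ) ^ (k + 1 + 1 - j) * (2 - 1 / 2 ^ (k + 1 + 1 - j)) * riemannZeta (j : ℂ)
    rw [Nat.sub_self] at e1
    rw [Finset.sum_Icc_succ_top (show 2 ≤ k + 1 + 1 by omega), e1]
    have hz : 2 * ∑ j ∈ Finset.Icc 2 (k + 1), (-1 : ℂ) ^ (k + 1 + 2 - j) *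
          (2 - 1 / 2 ^ (k + 1 + 2 - j)) * riemannZeta (j : ℂ) +
        3 * ∑ j ∈ Finset.Icc 2 (k + 1), (-1 : ℂ) ^ (k + 1 + 1 - j) *
          (2 - 1 / 2 ^ (k + 1 + 1 - j)) * riemannZeta (j : ℂ) +
        ∑ j ∈ Finset.Icc 2 (k + 1), (-1 : ℂ) ^ (k + 1 - j) *
          (2 - 1 / 2 ^ (k + 1 - j)) * riemannZeta (j : ℂ) = 0 := by
      rw [Finset.mul_sum, Finset.mul_sum, ← Finset.sum_add_distrib, ← Finset.sum_add_distrib]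
      refine Finset.sum_eq_zero fun j hj => ?_
      obtain ⟨d, hd⟩ := Nat.exists_eq_add_of_le (Finset.mem_Icc.1 hj).2
      rw [show k + 1 + 2 - j = d + 2 by omega, show k + 1 + 1 - j = d + 1 by omega,
        show k + 1 - j = d by omega]
      field_simp
      ring
    rw [show k + 1 + 2 - (k + 1 + 1) = 1 by omega]
    have hb : 2 * (-(-1 : ℂ) ^ (k + 1 + 2) * (2 - 3 / 2 ^ (k + 1 + 2))) +
        3 * (-(-1 : ℂ) ^ (k + 1 + 1) * (2 - 3 / 2 ^ (k + 1 + 1))) +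
        -(-1 : ℂ) ^ (k + 1) * (2 - 3 / 2 ^ (k + 1)) = 0 := by
      field_simp
      ring
    rw [show k + 1 + 1 + 1 = k + 1 + 2 by omega, Nat.sub_self]
    linear_combination hz + hb

lemma ZetaRecursion.eq_zetaCombinationValue {v : ℕ → ℝ} (hv : ZetaRecursion v) :
    (fun k => (v k : ℂ)) = zetaCombinationValue := by
  obtain ⟨h0, h1, h⟩ := hv
  refine eq_of_linear_recursion ?_ ?_ fun k => ?_
  · simp only [h0, zetaCombinationValue_eq]
    norm_num
  · simp only [h1, zetaCombinationValue_eq]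
    norm_num
  · rw [zetaCombinationValue_recursion, ← h (k + 2) (by omega)]
    rfl

/-! ### The digamma series from the Weierstrass product -/

/-- The factors of the Weierstrass product of `Γ (1 - z)`, in logarithmic form. -/
def logGammaTerm (i : ℕ) (z : ℂ) : ℂ := -Complex.log (1 - z / (i + 1)) - z / (i + 1)

lemma natCast_add_one_ne_zero (i : ℕ) : ((i : ℂ) + 1) ≠ 0 := Nat.cast_add_one_ne_zero i

lemma norm_div_natCast_add_one_le (i : ℕ) (z : ℂ) : ‖z / (i + 1)‖ ≤ ‖z‖ := by
  have h : ‖(i : ℂ) + 1‖ = (i : ℝ) + 1 := by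
    have := Complex.norm_natCast (i + 1)
    push_cast at this
    exact this
  rw [norm_div, h]
  exact div_le_self (norm_nonneg _) (by simp)

lemma one_sub_div_mem_slitPlane {z : ℂ} (hz : ‖z‖ < 1) (i : ℕ) :
    1 - z / (i + 1) ∈ Complex.slitPlane := by
  rw [sub_eq_add_neg]
  refine Complex.mem_slitPlane_of_norm_lt_one ?_
  rw [norm_neg]
  exact (norm_div_natCast_add_one_le i z).trans_lt hz

lemma natCast_add_one_sub_ne_zero {z : ℂ} (hz : ‖z‖ < 1) (i : ℕ) : (i : ℂ) + 1 - z ≠ 0 := by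
  have h := Complex.slitPlane_ne_zero (one_sub_div_mem_slitPlane hz i)
  have h1 := natCast_add_one_ne_zero i
  intro h0
  apply h
  rw [show 1 - z / ((i : ℂ) + 1) = ((i : ℂ) + 1 - z) / (i + 1) by field_simp, h0, zero_div]

lemma norm_logGammaTerm_le {r : ℝ} (hr : r < 1) {z : ℂ} (hz : ‖z‖ < r) (i : ℕ) :
    ‖logGammaTerm i z‖ ≤ (1 - r)⁻¹ / 2 * (1 / ((i : ℝ) + 1) ^ 2) := by
  have hz1 := hz.trans hr
  have hw := (norm_div_natCast_add_one_le i z).trans_lt hz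
  have h := Complex.norm_log_one_sub_inv_sub_self_le (hw.trans hr)
  rw [Complex.log_inv _ (Complex.slitPlane_arg_ne_pi (one_sub_div_mem_slitPlane hz1 i))] at h
  refine h.trans ?_
  have hn : ‖z / (i + 1)‖ ≤ 1 / ((i : ℝ) + 1) := by
    have h : ‖(i : ℂ) + 1‖ = (i : ℝ) + 1 := by
      have := Complex.norm_natCast (i + 1)
      push_cast at this
      exact this
    rw [norm_div, h]
    gcongr
  calc ‖z / (i + 1)‖ ^ 2 * (1 - ‖z / (i + 1)‖)⁻¹ / 2
      ≤ (1 / ((i : ℝ) + 1)) ^ 2 * (1 - r)⁻¹ / 2 := by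
        have h1 : 0 < 1 - r := sub_pos.2 hr
        have h2 : 0 ≤ (1 - ‖z / (i + 1)‖)⁻¹ := inv_nonneg.2 (by linarith)
        gcongr
    _ = _ := by rw [one_div_pow]; ring

lemma hasDerivAt_logGammaTerm {z : ℂ} (hz : ‖z‖ < 1) (i : ℕ) :
    HasDerivAt (logGammaTerm i) (1 / ((i : ℂ) + 1 - z) - 1 / (i + 1)) z := by
  have h1 := natCast_add_one_ne_zero i
  have h2 := natCast_add_one_sub_ne_zero hz i
  have hd : HasDerivAt (fun z : ℂ => z / ((i : ℂ) + 1)) (1 / (i + 1)) z :=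
    (hasDerivAt_id z).div_const _
  refine (((hd.const_sub 1).clog (one_sub_div_mem_slitPlane hz i)).neg.sub hd).congr_deriv ?_
  have h3 := Complex.slitPlane_ne_zero (one_sub_div_mem_slitPlane hz i)
  have e : 1 - z / ((i : ℂ) + 1) = ((i : ℂ) + 1 - z) / (i + 1) := by field_simp
  rw [e, neg_div, neg_neg, div_div_div_cancel_right₀ h1]

lemma exp_logGammaTerm {z : ℂ} (hz : ‖z‖ < 1) (i : ℕ) :
    Complex.exp (logGammaTerm i z) =
      ((i : ℂ) + 1) / (i + 1 - z) * Complex.exp (-(z / (i + 1))) := by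
  have h1 := natCast_add_one_ne_zero i
  rw [logGammaTerm, sub_eq_add_neg, Complex.exp_add, Complex.exp_neg,
    Complex.exp_log (Complex.slitPlane_ne_zero (one_sub_div_mem_slitPlane hz i))]
  congr 1
  have e : 1 - z / ((i : ℂ) + 1) = ((i : ℂ) + 1 - z) / (i + 1) := by field_simp
  rw [e, inv_div]

/-- In Euler's product, `n^(-z)` is split as `exp((H_n - log n) z) exp(-H_n z)`. The first factor
tends to `exp(γz)`; the second supplies the convergence factors `exp(-z/(i+1))`. -/
lemma gammaSeq_one_sub {z : ℂ} (hz : ‖z‖ < 1) {n : ℕ} (hn : n ≠ 0) :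
    Complex.GammaSeq (1 - z) n = (n : ℂ) / (n + 1 - z) *
      Complex.exp (((harmonic n : ℝ) - Real.log n : ℝ) * z) *
        Complex.exp (∑ i ∈ Finset.range n, logGammaTerm i z) := by
  have hn0 : (n : ℂ) ≠ 0 := Nat.cast_ne_zero.2 hn
  have hfac : (n.factorial : ℂ) = ∏ i ∈ Finset.range n, ((i : ℂ) + 1) := by
    rw [← Finset.prod_range_add_one_eq_factorial]
    push_cast
    rfl
  have hden : ∏ j ∈ Finset.range (n + 1), (1 - z + j) =
      (∏ i ∈ Finset.range n, ((i : ℂ) + 1 - z)) * (n + 1 - z) := by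
    rw [Finset.prod_range_succ]
    congr 1
    · exact Finset.prod_congr rfl fun i _ => by ring
    · ring
  have hH : ((harmonic n : ℝ) : ℂ) * z = ∑ i ∈ Finset.range n, z / ((i : ℂ) + 1) := by
    rw [harmonic]
    push_cast
    rw [Finset.sum_mul]
    exact Finset.sum_congr rfl fun i _ => by rw [div_eq_mul_inv, mul_comm]
  have hprod : Complex.exp (∑ i ∈ Finset.range n, logGammaTerm i z) =
      (∏ i ∈ Finset.range n, ((i : ℂ) + 1)) / (∏ i ∈ Finset.range n, ((i : ℂ) + 1 - z)) *
        Complex.exp (-(((harmonic n : ℝ) : ℂ) * z)) := by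
    rw [Complex.exp_sum, Finset.prod_congr rfl fun i _ => exp_logGammaTerm hz i,
      Finset.prod_mul_distrib, Finset.prod_div_distrib, ← Complex.exp_sum, Finset.sum_neg_distrib,
      hH]
  have hpow : (n : ℂ) ^ (1 - z) = n * Complex.exp (-((Real.log n : ℝ) * z)) := by
    rw [Complex.cpow_sub _ _ hn0, Complex.cpow_one, Complex.cpow_def_of_ne_zero hn0,
      Complex.exp_neg, ← Complex.natCast_log]
    rfl
  have hexp : Complex.exp (((harmonic n : ℝ) - Real.log n : ℝ) * z) *
      Complex.exp (-(((harmonic n : ℝ) : ℂ) * z)) = Complex.exp (-((Real.log n : ℝ) * z)) := by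
    rw [← Complex.exp_add]
    congr 1
    push_cast
    ring
  have h1 : ∏ i ∈ Finset.range n, ((i : ℂ) + 1 - z) ≠ 0 :=
    Finset.prod_ne_zero_iff.2 fun i _ => natCast_add_one_sub_ne_zero hz i
  have h2 := natCast_add_one_sub_ne_zero hz n
  rw [Complex.GammaSeq, hden, hfac, hprod, hpow, ← hexp]
  field_simp

lemma summable_inv_sq (c : ℝ) : Summable fun i : ℕ => c * (1 / ((i : ℝ) + 1) ^ 2) := by
  have h := (summable_nat_add_iff 1).2 (Real.summable_one_div_nat_pow.2 one_lt_two)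
  simpa using h.mul_left c

lemma summable_logGammaTerm {z : ℂ} (hz : ‖z‖ < 1) : Summable fun i => logGammaTerm i z := by
  obtain ⟨r, hzr, hr⟩ := exists_between hz
  exact Summable.of_norm_bounded (summable_inv_sq _) fun i => norm_logGammaTerm_le hr hzr i

lemma gamma_one_sub_eq_exp {z : ℂ} (hz : ‖z‖ < 1) :
    Complex.Gamma (1 - z) =
      Complex.exp (Real.eulerMascheroniConstant * z + ∑' i, logGammaTerm i z) := by
  refine tendsto_nhds_unique (Complex.GammaSeq_tendsto_Gamma (1 - z)) ?_
  have h1 : Tendsto (fun n : ℕ => (n : ℂ) / (n + 1 - z)) atTop (𝓝 1) := by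
    have h := tendsto_natCast_div_add_atTop (1 - z)
    refine h.congr fun n => ?_
    rw [add_sub_assoc]
  have h2 : Tendsto (fun n : ℕ => Complex.exp (((harmonic n : ℝ) - Real.log n : ℝ) * z)) atTop
      (𝓝 (Complex.exp (Real.eulerMascheroniConstant * z))) :=
    (Complex.continuous_exp.tendsto _).comp
      (((Complex.continuous_ofReal.tendsto _).comp Real.tendsto_harmonic_sub_log).mul_const z)
  have h3 : Tendsto (fun n : ℕ => Complex.exp (∑ i ∈ Finset.range n, logGammaTerm i z)) atTop
      (𝓝 (Complex.exp (∑' i, logGammaTerm i z))) :=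
    (Complex.continuous_exp.tendsto _).comp (summable_logGammaTerm hz).hasSum.tendsto_sum_nat
  have h := (h1.mul h2).mul h3
  rw [one_mul, ← Complex.exp_add] at h
  refine h.congr' ?_
  filter_upwards [eventually_ne_atTop 0] with n hn
  exact (gammaSeq_one_sub hz hn).symm

/-- This is the logarithmic derivative of `gamma_one_sub_eq_exp`; the quadratic bound on
`logGammaTerm` allows termwise differentiation. -/
theorem hasSum_digamma_one_sub {z : ℂ} (hz : ‖z‖ < 1) :
    HasSum (fun i : ℕ => 1 / ((i : ℂ) + 1 - z) - 1 / (i + 1))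
      (-Real.eulerMascheroniConstant - Complex.digamma (1 - z)) := by
  obtain ⟨r, hzr, hr⟩ := exists_between hz
  have hmem : z ∈ Metric.ball (0 : ℂ) r := by simpa using hzr
  have hdiff : ∀ i, DifferentiableOn ℂ (logGammaTerm i) (Metric.ball 0 r) := fun i w hw =>
    (hasDerivAt_logGammaTerm ((mem_ball_zero_iff.1 hw).trans hr) i).differentiableAt
      |>.differentiableWithinAt
  have hbound : ∀ (i : ℕ) (w : ℂ), w ∈ Metric.ball 0 r →
      ‖logGammaTerm i w‖ ≤ (1 - r)⁻¹ / 2 * (1 / ((i : ℝ) + 1) ^ 2) := fun i w hw =>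
    norm_logGammaTerm_le hr (mem_ball_zero_iff.1 hw) i
  have hsum := Complex.hasSum_deriv_of_summable_norm (summable_inv_sq _) hdiff Metric.isOpen_ball
    hbound hmem
  have hG := ((Complex.differentiableOn_tsum_of_summable_norm (summable_inv_sq _) hdiff
    Metric.isOpen_ball hbound).differentiableAt (Metric.isOpen_ball.mem_nhds hmem)).hasDerivAt
  simp only [(hasDerivAt_logGammaTerm hz _).deriv] at hsum
  have hE := (((hasDerivAt_id z).const_mul (Real.eulerMascheroniConstant : ℂ)).add hG).cexp
  have hne : Complex.Gamma (1 - z) ≠ 0 := by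
    rw [gamma_one_sub_eq_exp hz]
    exact Complex.exp_ne_zero _
  have hΓ : HasDerivAt Complex.Gamma (deriv Complex.Gamma (1 - z)) (1 - z) := by
    -- `Complex.Gamma` takes the value 0 at its poles, so nonvanishing rules them out.
    refine (Complex.differentiableAt_Gamma _ fun m h => hne ?_).hasDerivAt
    rw [h, Complex.Gamma_neg_nat_eq_zero]
  have hc := hΓ.comp z ((hasDerivAt_id z).const_sub 1)
  have heq : (Complex.Gamma ∘ fun w => 1 - id w) =ᶠ[𝓝 z] fun w =>
      Complex.exp (Real.eulerMascheroniConstant * w + ∑' i, logGammaTerm i w) := by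
    filter_upwards [Metric.isOpen_ball.mem_nhds hmem] with w hw
    exact gamma_one_sub_eq_exp ((mem_ball_zero_iff.1 hw).trans hr)
  have hu := hc.unique (hE.congr_of_eventuallyEq heq)
  have hval : Complex.exp (Real.eulerMascheroniConstant * z + ∑' i, logGammaTerm i z) =
      Complex.Gamma (1 - z) := (gamma_one_sub_eq_exp hz).symm
  simp only [id, Pi.add_apply, hval] at hu
  have hψ : -Real.eulerMascheroniConstant - Complex.digamma (1 - z) =
      deriv (fun w => ∑' i, logGammaTerm i w) z := by
    rw [Complex.digamma_def, logDeriv_apply]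
    field_simp
    linear_combination hu
  rwa [hψ]

/-! ### The generating function -/

lemma hasSum_geometric_div {z : ℂ} (hz : ‖z‖ < 1) (i : ℕ) :
    HasSum (fun k : ℕ => (2 / (((i : ℂ) + 1) ^ k * (i + 2) * (i + 3))) * z ^ k)
      (2 * (i + 1) / (((i : ℂ) + 2) * (i + 3) * (i + 1 - z))) := by
  have h1 := natCast_add_one_ne_zero i
  have h2 := natCast_add_one_sub_ne_zero hz i
  have h := (hasSum_geometric_of_norm_lt_one
    ((norm_div_natCast_add_one_le i z).trans_lt hz)).mul_left (2 / (((i : ℂ) + 2) * (i + 3)))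
  have e1 : 2 * ((i : ℂ) + 1) / (((i : ℂ) + 2) * (i + 3) * (i + 1 - z)) =
      2 / (((i : ℂ) + 2) * (i + 3)) * (1 - z / (i + 1))⁻¹ := by
    have e : 1 - z / ((i : ℂ) + 1) = ((i : ℂ) + 1 - z) / (i + 1) := by field_simp
    rw [e, inv_div, div_mul_div_comm]
  have e2 : ∀ k : ℕ, (2 / (((i : ℂ) + 1) ^ k * (i + 2) * (i + 3))) * z ^ k =
      2 / (((i : ℂ) + 2) * (i + 3)) * (z / (i + 1)) ^ k := by
    intro k
    rw [div_pow, div_mul_div_comm, div_mul_eq_mul_div]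
    congr 1
    ring
  rw [e1]
  simpa only [e2] using h

lemma one_add_ne_zero_of_norm_lt_one {z : ℂ} (hz : ‖z‖ < 1) : 1 + z ≠ 0 :=
  Complex.slitPlane_ne_zero (Complex.mem_slitPlane_of_norm_lt_one hz)

lemma two_add_ne_zero_of_norm_lt_one {z : ℂ} (hz : ‖z‖ < 1) : 2 + z ≠ 0 := by
  intro h
  rw [show z = -2 by linear_combination h] at hz
  norm_num at hz

lemma series_hasSum_partialFractions {s : ℕ → ℝ} (hs : ShiftedSeries s) {z : ℂ} (hz : ‖z‖ < 1) :
    HasSum (fun i : ℕ => 2 * (i + 1) / (((i : ℂ) + 2) * (i + 3) * (i + 1 - z)))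
      (2 / ((1 + z) * (2 + z)) *
        (1 + (2 - (Real.eulerMascheroniConstant : ℂ) - Complex.digamma (1 - z)) * z)) := by
  have hz1 := one_add_ne_zero_of_norm_lt_one hz
  have hz2 := two_add_ne_zero_of_norm_lt_one hz
  have hs0 := Complex.hasSum_ofReal.2 (hs 0)
  have hs1 := Complex.hasSum_ofReal.2 (hs 1)
  rw [series_zero hs] at hs0
  rw [series_one hs] at hs1
  -- Partial fractions in `j = i + 1`: `α` is the residue of `2j/((j+1)(j+2)(j-z))` at `j = z`. The
  -- remaining poles are matched by the series for `s 0` and `s 1`, whose sums are known.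
  set α : ℂ := 2 * z / ((1 + z) * (2 + z)) with hα
  have h := (((hasSum_digamma_one_sub hz).mul_left α).add (hs0.mul_left (1 - α * z / 2))).add
    (hs1.mul_left α)
  have e1 : 2 / ((1 + z) * (2 + z)) *
        (1 + (2 - (Real.eulerMascheroniConstant : ℂ) - Complex.digamma (1 - z)) * z) =
      α * (-Real.eulerMascheroniConstant - Complex.digamma (1 - z)) +
        (1 - α * z / 2) * ((1 : ℝ) : ℂ) + α * ((1 / 2 : ℝ) : ℂ) := by
    rw [hα]
    push_cast
    field_simp
    ring
  have e2 : ∀ i : ℕ, 2 * ((i : ℂ) + 1) / (((i : ℂ) + 2) * (i + 3) * (i + 1 - z)) =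
      α * (1 / ((i : ℂ) + 1 - z) - 1 / (i + 1)) +
        (1 - α * z / 2) * ((2 / (((i : ℝ) + 1) ^ 0 * ((i : ℝ) + 2) * ((i : ℝ) + 3)) : ℝ) : ℂ) +
        α * ((2 / (((i : ℝ) + 1) ^ 1 * ((i : ℝ) + 2) * ((i : ℝ) + 3)) : ℝ) : ℂ) := by
    intro i
    have h1 := natCast_add_one_ne_zero i
    have h2 := natCast_add_one_sub_ne_zero hz i
    have h3 : (i : ℂ) + 2 ≠ 0 := by exact_mod_cast (by omega : i + 2 ≠ 0)
    have h4 : (i : ℂ) + 3 ≠ 0 := by exact_mod_cast (by omega : i + 3 ≠ 0)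
    rw [hα]
    push_cast
    field_simp
    ring
  rw [e1]
  simpa only [e2] using h

lemma series_generatingFunction {s : ℕ → ℝ} (hs : ShiftedSeries s) : GeneratingFunction s := by
  intro z hz
  set F : ℕ × ℕ → ℂ := fun x =>
    (2 / (((x.2 : ℂ) + 1) ^ x.1 * (x.2 + 2) * (x.2 + 3))) * z ^ x.1 with hF
  have hnorm : ∀ i : ℕ, ∀ c : ℕ, ‖(i : ℂ) + ((c + 1 : ℕ) : ℂ)‖ = (i : ℝ) + ((c + 1 : ℕ) : ℝ) := by
    intro i c
    exact_mod_cast Complex.norm_natCast (i + (c + 1))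
  have hsF : Summable F := by
    -- Replacing `(i+1)^k` by 1 gives a summable product majorant, which justifies exchanging the
    -- sums.
    have hb : Summable fun x : ℕ × ℕ => ‖z‖ ^ x.1 *
        (2 / (((x.2 : ℝ) + 1) ^ 0 * ((x.2 : ℝ) + 2) * ((x.2 : ℝ) + 3))) :=
      (summable_geometric_of_lt_one (norm_nonneg z) hz).mul_of_nonneg (hs 0).summable
        (fun k => by positivity) fun i => by positivity
    refine Summable.of_norm_bounded hb fun x => ?_
    have h1 := hnorm x.2 0
    have h2 := hnorm x.2 1
    have h3 := hnorm x.2 2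
    norm_num at h1 h2 h3
    rw [hF]
    simp only [norm_mul, norm_div, norm_pow, h1, h2, h3, Complex.norm_ofNat]
    rw [mul_comm]
    have h4 : (1 : ℝ) ≤ (x.2 : ℝ) + 1 := by simp
    gcongr
    exact x.1.zero_le
  have hrow : ∀ k, HasSum (fun i => F (k, i)) ((s k : ℂ) * z ^ k) := by
    intro k
    have h := (Complex.hasSum_ofReal.2 (hs k)).mul_right (z ^ k)
    simpa [hF] using h
  have hcol : ∀ i, HasSum (fun k => F (k, i))
      (2 * (i + 1) / (((i : ℂ) + 2) * (i + 3) * (i + 1 - z))) := hasSum_geometric_div hz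
  have h1 := hsF.hasSum.prod_fiberwise hrow
  have h2 := ((Equiv.prodComm ℕ ℕ).hasSum_iff.2 hsF.hasSum).prod_fiberwise hcol
  rwa [h2.unique (series_hasSum_partialFractions hs hz)] at h1

lemma eq_of_generatingFunction {u v : ℕ → ℝ} (hu : GeneratingFunction u)
    (hv : GeneratingFunction v) : u = v := by
  have key : ∀ w : ℕ → ℝ, GeneratingFunction w → HasFPowerSeriesAt
      (fun z : ℂ => 2 / ((1 + z) * (2 + z)) *
        (1 + (2 - (Real.eulerMascheroniConstant : ℂ) - Complex.digamma (1 - z)) * z))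
      (FormalMultilinearSeries.ofScalars ℂ fun k => (w k : ℂ)) 0 := by
    intro w hw
    rw [hasFPowerSeriesAt_iff]
    filter_upwards [Metric.ball_mem_nhds (0 : ℂ) one_pos] with z hz
    have h := hw z (mem_ball_zero_iff.1 hz)
    simpa [FormalMultilinearSeries.coeff_ofScalars, mul_comm] using h
  have h := FormalMultilinearSeries.ofScalars_series_injective ℂ ℂ
    ((key u hu).eq_formalMultilinearSeries (key v hv))
  exact funext fun k => Complex.ofReal_injective (congrFun h k)

lemma series_tfae {s : ℕ → ℝ} (hs : ShiftedSeries s) (v : ℕ → ℝ) :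
    [v = s, ZetaRecursion v, ZetaCombination v, PositiveSeries v, GeneratingFunction v].TFAE := by
  tfae_have 1 → 2 := fun h => h ▸ series_recursion hs
  tfae_have 2 → 3 := fun h k => congrFun h.eq_zetaCombinationValue k
  tfae_have 3 → 1 := fun h => funext fun k => Complex.ofReal_injective
    ((h k).trans (congrFun (series_recursion hs).eq_zetaCombinationValue k).symm)
  tfae_have 1 → 4 := fun h => h ▸ series_positiveSeries hs
  tfae_have 4 → 1 := fun h => funext fun k => (h k).unique (series_positiveSeries hs k)
  tfae_have 1 → 5 := fun h => h ▸ series_generatingFunction hs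
  tfae_have 5 → 1 := fun h => eq_of_generatingFunction h (series_generatingFunction hs)
  tfae_finish

end StickBreaking

end

theorem proposition1p1 {Ω : Type*} [MeasurableSpace Ω] (μ : Measure Ω) [IsProbabilityMeasure μ]
    (W U : ℕ → Ω → ℝ)
    (hWm : ∀ i, Measurable (W i)) (hUm : ∀ j, Measurable (U j))
    (hWu : ∀ i, pdf.IsUniform (W i) (Set.Icc 0 1) μ)
    (hUu : ∀ j, pdf.IsUniform (U j) (Set.Icc 0 1) μ)
    (hWi : iIndepFun W μ) (hUi : iIndepFun U μ)
    (hWU : IndepFun (fun ω i => StickBreaking.stickLength W i ω) (fun ω j => U j ω) μ) :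
    StickBreaking.IsRenewalSequence (StickBreaking.renewalProb μ W U) ∧
    (∀ v : ℕ → ℝ,
      [v = StickBreaking.renewalProb μ W U,
        StickBreaking.ZetaRecursion v,
        StickBreaking.ZetaCombination v,
        StickBreaking.PositiveSeries v,
        StickBreaking.GeneratingFunction v].TFAE) ∧
    Tendsto (StickBreaking.renewalProb μ W U) atTop (𝓝 (1 / 3)) := by
  have hs : StickBreaking.ShiftedSeries (StickBreaking.renewalProb μ W U) :=
    StickBreaking.hasSum_renewalProb hWm hUm hWu hUu hWi hUi hWU
  exact ⟨StickBreaking.series_isRenewalSequence hs, StickBreaking.series_tfae hs,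
    StickBreaking.series_tendsto hs⟩
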